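/- Let $Q$ be a finite-dimensional smooth manifold, let $L:TQ\times\mathbb R\to\mathbb R$ be a smooth function, and let $\Delta\subseteq TQ$ be a regular (smooth, constant-rank) distribution of codimension $k$. Let $a<b$ and $q_1,q_2\in Q$. Let $\Omega(q_1,q_2,[a,b])$ be the space of smooth curves $\xi:[a,b]\to Q$ with $\xi(a)=q_1$, $\xi(b)=q_2$. Its tangent space $T_\xi\Omega(q_1,q_2,[a,b])$ at $\xi$ consists of the smooth vector fields $v$ along $\xi$ with $v(a)=0$ and $v(b)=0$. For a curve $\xi$, let $\mathcal Z(\xi):[a,b]\to\mathbb R$ be the solution of $$\frac{d}{dt}\mathcal Z(\xi)(t)=L\big(\xi(t),\dot\xi(t),\mathcal Z(\xi)(t)\big),\qquad \mathcal Z(\xi)(a)=0,$$ whenever it exists on all of $[a,b]$, and let $\mathcal A(\xi)=\mathcal Z(\xi)(b)$ be the Herglotz action. For $v\in T_\xi\Omega(q_1,q_2,[a,b])$, $T_\xi\mathcal A(v)$ denotes the derivative $\frac{d}{ds}\big|_{s=0}\mathcal A(c_s)$ along smooth curves $s\mapsto c_s$ in $\Omega(q_1,q_2,[a,b])$ with $c_0=\xi$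 and $\partial_s c_s|_{s=0}=v$. A path $\xi\in\Omega(q_1,q_2,[a,b])$ for which $\mathcal Z(\xi)$ exists on $[a,b]$ is said to satisfy the Herglotz variational principle with constraints $\Delta$ if 1. $T_\xi\mathcal A(v)=0$ for all $v\in T_\xi\Omega(q_1,q_2,[a,b])$ with $v(t)\in\Delta_{\xi(t)}$ for all $t\in[a,b]$, and 2. $\dot\xi(t)\in\Delta_{\xi(t)}$ for all $t\in[a,b]$. **Theorem.** A path $\xi\in\Omega(q_1,q_2,[a,b])$ for which $\mathcal Z(\xi)$ exists on $[a,b]$ satisfies the Herglotz variational principle with constraints $\Delta$ if and only if, for all $t\in[a,b]$, $$\left(\frac{\partial L}{\partial q^i}-\frac{d}{dt}\frac{\partial L}{\partial\dot q^i}+\frac{\partial L}{\partial\dot q^i}\frac{\partial L}{\partial z}\right)dq^i\in\Delta^\circ_{\xi(t)}\qquad\text{and}\qquad\dot\xi(t)\in\Delta_{\xi(t)},$$ where the derivatives of $L$ are evaluated along $(\xi,\dot\xi,\mathcal Z(\xi))$, the first expression is computed, for each $t$, in an arbitrary chart $(q^i)$ of $Q$ around $\xi(t)$, and $\Delta^\circ=\{\alpha\in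 T^*Q\mid\alpha(u)=0\text{ for all }u\in\Delta\}$ is the annihilator of $\Delta$ (with $u$ in the fibre over the base point of $\alpha$). -/

import Mathlib

open Set Filter Topology
open scoped Manifold ContDiff

noncomputable section

namespace Herglotz

section Curves

variable {E : Type*} [NormedAddCommGroup E] [NormedSpace ℝ E]
  {Q : Type*} [TopologicalSpace Q] [ChartedSpace E Q] [IsManifold 𝓘(ℝ, E) ∞ Q]

/-- The space `Ω(q₁, q₂, [a, b])` of smooth curves `ξ : [a, b] → Q` from `q₁` to `q₂`.
A curve on `[a, b]` is the restriction to `Icc a b` of a function on `ℝ`, smooth up to the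
endpoints; its values outside `Icc a b` are never used. -/
structure IsPath (a b : ℝ) (q₁ q₂ : Q) (ξ : ℝ → Q) : Prop where
  smooth : ContMDiffOn 𝓘(ℝ, ℝ) 𝓘(ℝ, E) ∞ ξ (Icc a b)
  left : ξ a = q₁
  right : ξ b = q₂

/-- The velocity `ξ̇(t) ∈ T_{ξ(t)} Q` of a curve on `[a, b]` (one-sided at the endpoints). -/
def velocity (a b : ℝ) (ξ : ℝ → Q) (t : ℝ) : TangentSpace 𝓘(ℝ, E) (ξ t) :=
  mfderivWithin 𝓘(ℝ, ℝ) 𝓘(ℝ, E) ξ (Icc a b) t (1 : ℝ)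

/-- The tangent space `T_ξ Ω(q₁, q₂, [a, b])`: smooth vector fields along `ξ` that vanish at
the endpoints. -/
structure IsInfinitesimalVariation (a b : ℝ) (ξ : ℝ → Q)
    (v : (t : ℝ) → TangentSpace 𝓘(ℝ, E) (ξ t)) : Prop where
  smooth : ContMDiffOn 𝓘(ℝ, ℝ) 𝓘(ℝ, E).tangent ∞
    (fun t => (⟨ξ t, v t⟩ : TangentBundle 𝓘(ℝ, E) Q)) (Icc a b)
  left : v a = 0
  right : v b = 0

/-- `c` is a smooth curve `s ↦ c s` in `Ω(q₁, q₂, [a, b])`, defined for `s` near `0`, which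
passes through `ξ` at `s = 0` with velocity `v`. -/
structure IsVariation (a b : ℝ) (q₁ q₂ : Q) (ξ : ℝ → Q)
    (v : (t : ℝ) → TangentSpace 𝓘(ℝ, E) (ξ t)) (c : ℝ → ℝ → Q) : Prop where
  smooth_and_endpoints : ∃ ε > 0,
    ContMDiffOn 𝓘(ℝ, ℝ × ℝ) 𝓘(ℝ, E) ∞ (fun p : ℝ × ℝ => c p.1 p.2)
      (Ioo (-ε) ε ×ˢ Icc a b) ∧
    ∀ s ∈ Ioo (-ε) ε, c s a = q₁ ∧ c s b = q₂
  base : ∀ t ∈ Icc a b, c 0 t = ξ t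
  velocity_eq : ∀ t ∈ Icc a b,
    (⟨c 0 t, mfderiv 𝓘(ℝ, ℝ) 𝓘(ℝ, E) (fun s => c s t) 0 (1 : ℝ)⟩ : TangentBundle 𝓘(ℝ, E) Q)
      = ⟨ξ t, v t⟩

/-- `z` solves `ż = L(ξ, ξ̇, z)` on `[a, b]` with `z(a) = 0`. -/
structure IsHerglotzSolution (L : TangentBundle 𝓘(ℝ, E) Q × ℝ → ℝ) (a b : ℝ)
    (ξ : ℝ → Q) (z : ℝ → ℝ) : Prop where
  initial : z a = 0
  deriv_eq : ∀ t ∈ Icc a b,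
    HasDerivWithinAt z (L (⟨ξ t, velocity a b ξ t⟩, z t)) (Icc a b) t

/-- The Herglotz equation along `ξ` has a solution on all of `[a, b]`, that is, `ξ` lies in the
domain of the operator `𝒵` and of the action. -/
def InActionDomain (L : TangentBundle 𝓘(ℝ, E) Q × ℝ → ℝ) (a b : ℝ) (ξ : ℝ → Q) : Prop :=
  ∃ z : ℝ → ℝ, IsHerglotzSolution L a b ξ z

open Classical in
/-- The operator `𝒵`: the solution along `ξ` (unique on `[a, b]` for smooth `L` and `ξ`).
Curves outside of the domain get the value `0`. For smooth `L` the domain is open, so this value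
does not enter the derivative of the action at a curve of the domain. -/
def herglotzZ (L : TangentBundle 𝓘(ℝ, E) Q × ℝ → ℝ) (a b : ℝ) (ξ : ℝ → Q) : ℝ → ℝ :=
  if h : InActionDomain L a b ξ then h.choose else 0

/-- The Herglotz action `𝒜(ξ) = 𝒵(ξ)(b)`. -/
def action (L : TangentBundle 𝓘(ℝ, E) Q × ℝ → ℝ) (a b : ℝ) (ξ : ℝ → Q) : ℝ :=
  herglotzZ L a b ξ b

/-- `T_ξ 𝒜 (v) = ℓ`: along every smooth curve in `Ω(q₁, q₂, [a, b])` through `ξ` with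
velocity `v`, the action is differentiable at `ξ` with derivative `ℓ`. -/
def HasActionDeriv (L : TangentBundle 𝓘(ℝ, E) Q × ℝ → ℝ) (a b : ℝ) (q₁ q₂ : Q)
    (ξ : ℝ → Q) (v : (t : ℝ) → TangentSpace 𝓘(ℝ, E) (ξ t)) (ℓ : ℝ) : Prop :=
  ∀ c : ℝ → ℝ → Q, IsVariation a b q₁ q₂ ξ v c →
    HasDerivAt (fun s => action L a b (c s)) ℓ 0

/-- A regular distribution of codimension `k` on `Q`: a smooth field of subspaces
`Δ q ⊆ T_q Q`, locally spanned by `dim Q - k` smooth, pointwise independent vector fields. -/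
def IsRegularDistribution (k : ℕ) (Δ : (q : Q) → Submodule ℝ (TangentSpace 𝓘(ℝ, E) q)) : Prop :=
  ∃ r : ℕ, r + k = Module.finrank ℝ E ∧
    ∀ q₀ : Q, ∃ U : Set Q, IsOpen U ∧ q₀ ∈ U ∧
      ∃ X : Fin r → (q : Q) → TangentSpace 𝓘(ℝ, E) q,
        (∀ i, ContMDiffOn 𝓘(ℝ, E) 𝓘(ℝ, E).tangent ∞
          (fun q => (⟨q, X i q⟩ : TangentBundle 𝓘(ℝ, E) Q)) U) ∧
        ∀ q ∈ U, LinearIndependent ℝ (fun i => X i q) ∧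
          Δ q = Submodule.span ℝ (Set.range fun i => X i q)

/-- The Herglotz variational principle with constraints `Δ` for the path `ξ`. -/
structure SatisfiesConstrainedPrinciple (L : TangentBundle 𝓘(ℝ, E) Q × ℝ → ℝ)
    (Δ : (q : Q) → Submodule ℝ (TangentSpace 𝓘(ℝ, E) q)) (a b : ℝ) (q₁ q₂ : Q)
    (ξ : ℝ → Q) : Prop where
  critical : ∀ v : (t : ℝ) → TangentSpace 𝓘(ℝ, E) (ξ t),
    IsInfinitesimalVariation a b ξ v → (∀ t ∈ Icc a b, v t ∈ Δ (ξ t)) →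
      HasActionDeriv L a b q₁ q₂ ξ v 0
  constraint : ∀ t ∈ Icc a b, velocity a b ξ t ∈ Δ (ξ t)

/-- The Lagrangian in the coordinates `(q, q̇, z)` induced by the chart `e`. -/
def chartLagrangian (L : TangentBundle 𝓘(ℝ, E) Q × ℝ → ℝ) (e : OpenPartialHomeomorph Q E)
    (q w : E) (z : ℝ) : ℝ :=
  L (⟨e.symm q, mfderiv 𝓘(ℝ, E) 𝓘(ℝ, E) e.symm q w⟩, z)

/-- The velocity `q̇(t)` of `ξ` in the chart `e`. -/
def chartVelocity (e : OpenPartialHomeomorph Q E) (a b : ℝ) (ξ : ℝ → Q) (t : ℝ) : E :=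
  derivWithin (fun τ => e (ξ τ)) (Icc a b) t

/-- The covector `∂L/∂q` along `(ξ, ξ̇, 𝒵(ξ))` in the chart `e`. -/
def partialPosition (L : TangentBundle 𝓘(ℝ, E) Q × ℝ → ℝ) (e : OpenPartialHomeomorph Q E)
    (a b : ℝ) (ξ : ℝ → Q) (t : ℝ) : E →L[ℝ] ℝ :=
  fderiv ℝ (fun q => chartLagrangian L e q (chartVelocity e a b ξ t) (herglotzZ L a b ξ t))
    (e (ξ t))

/-- The covector `∂L/∂q̇` along `(ξ, ξ̇, 𝒵(ξ))` in the chart `e`. -/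
def partialVelocity (L : TangentBundle 𝓘(ℝ, E) Q × ℝ → ℝ) (e : OpenPartialHomeomorph Q E)
    (a b : ℝ) (ξ : ℝ → Q) (t : ℝ) : E →L[ℝ] ℝ :=
  fderiv ℝ (fun w => chartLagrangian L e (e (ξ t)) w (herglotzZ L a b ξ t))
    (chartVelocity e a b ξ t)

/-- The number `∂L/∂z` along `(ξ, ξ̇, 𝒵(ξ))`. -/
def partialAction (L : TangentBundle 𝓘(ℝ, E) Q × ℝ → ℝ) (a b : ℝ) (ξ : ℝ → Q) (t : ℝ) : ℝ :=
  deriv (fun z => L (⟨ξ t, velocity a b ξ t⟩, z)) (herglotzZ L a b ξ t)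

/-- The covector `(∂L/∂qⁱ - d/dt ∂L/∂q̇ⁱ + ∂L/∂q̇ⁱ ∂L/∂z) dqⁱ` at `ξ(t)`, computed in the
chart `e` around `ξ(t)`. -/
def herglotzCovector (L : TangentBundle 𝓘(ℝ, E) Q × ℝ → ℝ) (e : OpenPartialHomeomorph Q E)
    (a b : ℝ) (ξ : ℝ → Q) (t : ℝ) : Module.Dual ℝ (TangentSpace 𝓘(ℝ, E) (ξ t)) :=
  (show E →L[ℝ] ℝ from
    partialPosition L e a b ξ t
      - derivWithin (partialVelocity L e a b ξ) (Icc a b) t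
      + partialAction L a b ξ t • partialVelocity L e a b ξ t).toLinearMap ∘ₗ
    (show TangentSpace 𝓘(ℝ, E) (ξ t) →L[ℝ] E from
      mfderiv 𝓘(ℝ, E) 𝓘(ℝ, E) e (ξ t)).toLinearMap

end Curves

end Herglotz

end

/-! Let `c s` be a variation of `ξ` with velocity `v`, let `z = 𝒵(ξ)`, and let `E` be the Herglotz
covector. Differentiating the Herglotz equation in `s` shows that the derivative of the action is `w
b`, where `w a = 0`, `w' = F + (∂L/∂z) w` and `F` is the `s`-derivative at `0` of `L` along `c s`
with `z` held fixed (`hasDerivAt_action_variation`). Existence of the nearby solutions on all of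
`[a, b]` and differentiability in `s` come from Picard–Lindelöf and Grönwall.

The momentum pairing `p = ⟨∂L/∂q̇, v⟩` obeys `p' = F + (∂L/∂z) p - E(v)`: in coordinates both `F`
and `p'` contain `∂L/∂q̇` applied to the mixed second derivative of the variation, and this term
cancels (`hasDerivWithinAt_momentumPairing`). Hence `y = w - p` solves `y' = E(v) + (∂L/∂z) y` with
`y a = 0`, and `y b = w b` because `v` vanishes at the endpoints (`first_variation_formula`). Since
`p` is defined without a chart, `E` may be computed in a different chart at each time.

If `E` annihilates `Δ`, the equation for `y` is homogeneous, so `y = 0` and the action is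
stationary. Conversely, suppose `E(u) > 0` for some `u ∈ Δ`. Extend `u` to a local section `X` of
`Δ` and take `v = φ X` with a bump `φ` supported where `E(X) > 0`. The source `E(v)` is then
nonnegative, while criticality forces `y a = y b = 0`. After multiplication by an integrating factor
`y` is monotone, hence zero, so the source vanishes on `(a, b)`, contradicting positivity at the
centre of the bump. -/

noncomputable section

namespace Herglotz

/-! ### Scalar linear differential equations and Grönwall estimates -/

section ScalarODE

variable {a b : ℝ}

theorem hasDerivWithinAt_Ici_of_Icc {f : ℝ → ℝ} {f' t : ℝ} (ht : t ∈ Ico a b)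
    (h : HasDerivWithinAt f f' (Icc a b) t) : HasDerivWithinAt f f' (Ici t) t :=
  h.mono_of_mem_nhdsWithin (mem_of_superset (Icc_mem_nhdsGE ht.2) (Icc_subset_Icc_left ht.1))

/-- Grönwall's inequality on `[a, b]` for a function vanishing at `a`. -/
theorem abs_le_mul_exp_of_abs_deriv_le {f f' : ℝ → ℝ} {K η : ℝ} (hK : 1 ≤ K) (hη : 0 ≤ η)
    (hf : ∀ t ∈ Icc a b, HasDerivWithinAt f (f' t) (Icc a b) t) (ha : f a = 0)
    (bound : ∀ t ∈ Icc a b, |f' t| ≤ K * |f t| + η) :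
    ∀ t ∈ Icc a b, |f t| ≤ η * Real.exp (K * (b - a)) := by
  intro t ht
  have h := norm_le_gronwallBound_of_norm_deriv_right_le (f := f) (f' := f') (δ := 0) (K := K)
    (ε := η) (a := a) (b := b) (fun t ht => (hf t ht).continuousWithinAt)
    (fun t ht => hasDerivWithinAt_Ici_of_Icc ht (hf t (Ico_subset_Icc_self ht))) (by simp [ha])
    (fun t ht => bound t (Ico_subset_Icc_self ht)) t ht
  rw [gronwallBound_of_K_ne_0 (by positivity)] at h
  -- The assumption `1 ≤ K` is what removes the denominator of the Grönwall bound.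
  have h1 : η / K ≤ η := div_le_self hη hK
  have h2 : Real.exp (K * (t - a)) ≤ Real.exp (K * (b - a)) :=
    Real.exp_le_exp.2 (mul_le_mul_of_nonneg_left (by linarith [ht.2]) (by positivity))
  have h3 : 1 ≤ Real.exp (K * (t - a)) :=
    Real.one_le_exp (mul_nonneg (by positivity) (by linarith [ht.1]))
  calc |f t| ≤ 0 * Real.exp (K * (t - a)) + η / K * (Real.exp (K * (t - a)) - 1) := h
    _ ≤ η * (Real.exp (K * (t - a)) - 1) := by
        rw [zero_mul, zero_add]; exact mul_le_mul_of_nonneg_right h1 (by linarith)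
    _ ≤ η * Real.exp (K * (b - a)) := mul_le_mul_of_nonneg_left (by linarith) hη

theorem exists_antideriv (hab : a ≤ b) {α : ℝ → ℝ} (hα : ContinuousOn α (Icc a b)) :
    ∃ A : ℝ → ℝ, A a = 0 ∧ ∀ t ∈ Icc a b, HasDerivWithinAt A (α t) (Icc a b) t := by
  have hc : Continuous (IccExtend hab ((Icc a b).domRestrict α)) :=
    (continuousOn_iff_continuous_domRestrict.1 hα).Icc_extend'
  refine ⟨fun t => ∫ τ in a..t, IccExtend hab ((Icc a b).domRestrict α) τ, by simp, fun t ht => ?_⟩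
  have := (hc.integral_hasStrictDerivAt a t).hasDerivAt.hasDerivWithinAt (s := Icc a b)
  rwa [IccExtend_of_mem _ _ ht] at this

/-- Variation of constants: with `A' = α`, the solution is `exp A` times an antiderivative of `exp
(-A) β`. -/
theorem exists_linear_ode_solution (hab : a ≤ b) {α β : ℝ → ℝ} (hα : ContinuousOn α (Icc a b))
    (hβ : ContinuousOn β (Icc a b)) :
    ∃ w : ℝ → ℝ, w a = 0 ∧
      ∀ t ∈ Icc a b, HasDerivWithinAt w (β t + α t * w t) (Icc a b) t := by
  obtain ⟨A, -, hA⟩ := exists_antideriv hab hα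
  have hAc : ContinuousOn A (Icc a b) := fun t ht => (hA t ht).continuousWithinAt
  obtain ⟨B, hB0, hB⟩ := exists_antideriv hab (α := fun t => Real.exp (-A t) * β t)
    ((Real.continuous_exp.comp_continuousOn hAc.neg).mul hβ)
  refine ⟨fun t => Real.exp (A t) * B t, by simp [hB0], fun t ht => ?_⟩
  have := (hA t ht).exp.mul (hB t ht)
  refine this.congr_deriv ?_
  have h1 : Real.exp (A t) * Real.exp (-A t) = 1 := by rw [← Real.exp_add]; simp
  linear_combination β t * h1

theorem linear_ode_eq_zero {α y : ℝ → ℝ} (hα : ContinuousOn α (Icc a b))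
    (hy : ∀ t ∈ Icc a b, HasDerivWithinAt y (α t * y t) (Icc a b) t) (ha : y a = 0) :
    ∀ t ∈ Icc a b, y t = 0 := by
  obtain ⟨K, hK⟩ := isCompact_Icc.exists_bound_of_continuousOn hα
  intro t ht
  have := abs_le_mul_exp_of_abs_deriv_le (K := max K 1) (η := 0) (le_max_right _ _) le_rfl hy ha
    (fun t ht => by
      rw [abs_mul, add_zero]
      exact mul_le_mul_of_nonneg_right ((hK t ht).trans (le_max_left _ _)) (abs_nonneg _)) t ht
  simpa using this

/-- If `y' = α y + g` with `g` of constant sign and `y` vanishes at both endpoints, then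
`g` vanishes in the interior. -/
theorem linear_ode_source_eq_zero (hab : a ≤ b) {α y g : ℝ → ℝ}
    (hα : ContinuousOn α (Icc a b))
    (hy : ∀ t ∈ Icc a b, HasDerivWithinAt y (g t + α t * y t) (Icc a b) t)
    (hg : ∀ t ∈ Icc a b, 0 ≤ g t) (ha : y a = 0) (hb : y b = 0) {t : ℝ} (ht : t ∈ Ioo a b) :
    g t = 0 := by
  obtain ⟨A, -, hA⟩ := exists_antideriv hab hα
  -- The integrating factor removes the linear term: `m' = exp (-A) g ≥ 0`. A monotone function with
  -- equal values at both ends is constant.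
  set m : ℝ → ℝ := fun t => Real.exp (-A t) * y t with hm
  have hm' : ∀ t ∈ Icc a b, HasDerivWithinAt m (Real.exp (-A t) * g t) (Icc a b) t := by
    intro t ht
    refine ((hA t ht).neg.exp.mul (hy t ht)).congr_deriv ?_
    simp only [Pi.neg_apply]
    ring
  have hmono : MonotoneOn m (Icc a b) := by
    refine monotoneOn_of_hasDerivWithinAt_nonneg (convex_Icc a b)
      (fun t ht => (hm' t ht).continuousWithinAt)
      (fun t ht => (hm' t (interior_subset ht)).mono interior_subset) fun t ht => ?_
    exact mul_nonneg (Real.exp_pos _).le (hg t (interior_subset ht))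
  have hm0 : ∀ t ∈ Icc a b, m t = 0 := by
    intro t ht
    have h1 := hmono (left_mem_Icc.2 hab) ht ht.1
    have h2 := hmono ht (right_mem_Icc.2 hab) ht.2
    have h3 : m a = 0 := by simp [hm, ha]
    have h4 : m b = 0 := by simp [hm, hb]
    linarith
  have ht' := Ioo_subset_Icc_self ht
  have h5 : HasDerivWithinAt m 0 (Icc a b) t :=
    (hasDerivWithinAt_const t _ (0 : ℝ)).congr hm0 (hm0 t ht')
  have h6 := (uniqueDiffOn_Icc (ht.1.trans ht.2) t ht').eq_deriv _ (hm' t ht') h5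
  exact (mul_eq_zero.1 h6).resolve_left (Real.exp_ne_zero _)

end ScalarODE

/-! ### Dependence of solutions on a parameter -/

section ParametricODE

/-- Solutions on `[a, b]` of `d' = H s t d` with `d a = 0`. -/
def SolvesFromZero (a b : ℝ) (f : ℝ → ℝ → ℝ) (d : ℝ → ℝ) : Prop :=
  d a = 0 ∧ ∀ t ∈ Icc a b, HasDerivWithinAt d (f t (d t)) (Icc a b) t

variable {a b ε : ℝ} {H : ℝ → ℝ → ℝ → ℝ} {D : ℝ → ℝ → ℝ → ((ℝ × ℝ) →L[ℝ] ℝ)}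

/-- The derivative is bounded on a compact box, the box is convex, and the mean value inequality
applies. The maximum is the norm of `ℝ × ℝ`. -/
theorem exists_lipschitz_bound
    (hH : ∀ s ∈ Ioo (-ε) ε, ∀ t ∈ Icc a b, ∀ d,
      HasFDerivAt (fun q : ℝ × ℝ => H q.1 t q.2) (D s t d) (s, d))
    (hDc : ContinuousOn (fun p : (ℝ × ℝ) × ℝ => D p.1.1 p.1.2 p.2)
      ((Ioo (-ε) ε ×ˢ Icc a b) ×ˢ univ)) {ρ : ℝ} (hρ : ρ < ε) (R : ℝ) :
    ∃ K : ℝ, 1 ≤ K ∧ ∀ t ∈ Icc a b, ∀ s ∈ Icc (-ρ) ρ, ∀ s' ∈ Icc (-ρ) ρ,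
      ∀ d ∈ Icc (-R) R, ∀ d' ∈ Icc (-R) R,
        |H s' t d' - H s t d| ≤ K * max |s' - s| |d' - d| := by
  have hsub : Icc (-ρ) ρ ⊆ Ioo (-ε) ε := fun s hs => ⟨by linarith [hs.1], by linarith [hs.2]⟩
  have hsub3 : (Icc (-ρ) ρ ×ˢ Icc a b) ×ˢ Icc (-R) R ⊆ (Ioo (-ε) ε ×ˢ Icc a b) ×ˢ univ :=
    prod_mono (prod_mono hsub subset_rfl) (subset_univ _)
  obtain ⟨K, hK⟩ := ((isCompact_Icc.prod isCompact_Icc).prod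
    isCompact_Icc).exists_bound_of_continuousOn (hDc.mono hsub3)
  refine ⟨max K 1, le_max_right _ _, fun t ht s hs s' hs' d hd d' hd' => ?_⟩
  have := (convex_Icc (-ρ) ρ |>.prod (convex_Icc (-R) R)).norm_image_sub_le_of_norm_hasFDerivWithin_le
    (f := fun q : ℝ × ℝ => H q.1 t q.2) (f' := fun q => D q.1 t q.2) (C := max K 1)
    (fun q hq => (hH q.1 (hsub hq.1) t ht q.2).hasFDerivWithinAt)
    (fun q hq => (hK ((q.1, t), q.2) ⟨⟨hq.1, ht⟩, hq.2⟩).trans (le_max_left _ _))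
    (x := (s, d)) (y := (s', d')) ⟨hs, hd⟩ ⟨hs', hd'⟩
  simpa [Prod.norm_def] using this

theorem solvesFromZero_unique
    (hH : ∀ s ∈ Ioo (-ε) ε, ∀ t ∈ Icc a b, ∀ d,
      HasFDerivAt (fun q : ℝ × ℝ => H q.1 t q.2) (D s t d) (s, d))
    (hDc : ContinuousOn (fun p : (ℝ × ℝ) × ℝ => D p.1.1 p.1.2 p.2)
      ((Ioo (-ε) ε ×ˢ Icc a b) ×ˢ univ)) {s : ℝ} (hs : s ∈ Ioo (-ε) ε) {d d' : ℝ → ℝ}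
    (hd : SolvesFromZero a b (H s) d) (hd' : SolvesFromZero a b (H s) d') :
    EqOn d d' (Icc a b) := by
  obtain ⟨R, hR⟩ := isCompact_Icc.exists_bound_of_continuousOn
    (fun t ht => (hd.2 t ht).continuousWithinAt : ContinuousOn d (Icc a b))
  obtain ⟨R', hR'⟩ := isCompact_Icc.exists_bound_of_continuousOn
    (fun t ht => (hd'.2 t ht).continuousWithinAt : ContinuousOn d' (Icc a b))
  -- The box must contain both solutions; `|s|` is the smallest radius that reaches `s`, and it is
  -- still below `ε`.
  obtain ⟨K, hK1, hK⟩ := exists_lipschitz_bound hH hDc (ρ := |s|) (abs_lt.2 hs) (max R R')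
  have hs' : s ∈ Icc (-|s|) |s| := abs_le.1 le_rfl
  intro t ht
  have := abs_le_mul_exp_of_abs_deriv_le (f := fun t => d t - d' t) (K := K) (η := 0) hK1 le_rfl
    (fun t ht => (hd.2 t ht).sub (hd'.2 t ht)) (by simp [hd.1, hd'.1])
    (fun t ht => by
      have := hK t ht s hs' s hs' (d' t) (abs_le.1 ((hR' t ht).trans (le_max_right _ _)))
        (d t) (abs_le.1 ((hR t ht).trans (le_max_left _ _)))
      simpa using this) t ht
  simpa [sub_eq_zero] using this

/-- Solutions could blow up before `b`, so the equation is first truncated in `d` to `[-1, 1]`,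
where Picard–Lindelöf works on the whole interval. Grönwall bounds the solution by `C * |s|`, so for
small `s` it never meets the truncation and solves the original equation. -/
theorem exists_solvesFromZero (hε : 0 < ε) (hab : a ≤ b)
    (hH : ∀ s ∈ Ioo (-ε) ε, ∀ t ∈ Icc a b, ∀ d,
      HasFDerivAt (fun q : ℝ × ℝ => H q.1 t q.2) (D s t d) (s, d))
    (hDc : ContinuousOn (fun p : (ℝ × ℝ) × ℝ => D p.1.1 p.1.2 p.2)
      ((Ioo (-ε) ε ×ˢ Icc a b) ×ˢ univ))
    (hHc : ContinuousOn (fun p : (ℝ × ℝ) × ℝ => H p.1.1 p.1.2 p.2)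
      ((Ioo (-ε) ε ×ˢ Icc a b) ×ˢ univ))
    (H0 : ∀ t ∈ Icc a b, H 0 t 0 = 0) :
    ∃ C : ℝ, 1 ≤ C ∧ ∀ᶠ s in 𝓝 (0 : ℝ), ∃ d, SolvesFromZero a b (H s) d ∧
      ∀ t ∈ Icc a b, |d t| ≤ C * |s| := by
  obtain ⟨K, hK1, hK⟩ := exists_lipschitz_bound hH hDc (ρ := ε / 2) (by linarith) 1
  have hK0 : 0 ≤ K := by linarith
  set κ : ℝ → ℝ := fun d => max (-1) (min 1 d) with hκ
  have hκm : ∀ d, κ d ∈ Icc (-1 : ℝ) 1 := fun d =>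
    ⟨le_max_left _ _, max_le (by norm_num) (min_le_left _ _)⟩
  have hκl : ∀ d d', |κ d - κ d'| ≤ |d - d'| := fun d d' => by
    refine (abs_max_sub_max_le_max _ _ _ _).trans (max_le (by simp) ?_)
    exact (abs_min_sub_min_le_max _ _ _ _).trans (max_le (by simp) le_rfl)
  have hκid : ∀ d, |d| ≤ 1 → κ d = d := fun d hd => by
    rw [abs_le] at hd
    simp [hκ, hd.1, hd.2]
  have hκ0 : κ 0 = 0 := hκid 0 (by simp)
  set C := K * Real.exp (K * (b - a)) with hC
  have hexp : 1 ≤ Real.exp (K * (b - a)) :=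
    Real.one_le_exp (mul_nonneg hK0 (by linarith))
  have hC1 : 1 ≤ C := by nlinarith
  refine ⟨C, hC1, ?_⟩
  -- The first radius keeps `s` in the box where `K` is valid; the second gives `C * |s| ≤ 1`, which
  -- makes the truncation inactive.
  have hρ : 0 < min (ε / 2) (1 / C) := lt_min (by linarith) (by positivity)
  filter_upwards [Icc_mem_nhds (neg_lt_zero.2 hρ) hρ] with s hs
  have hsabs : |s| ≤ min (ε / 2) (1 / C) := abs_le.2 hs
  have hs2 : s ∈ Icc (-(ε / 2)) (ε / 2) := abs_le.1 (hsabs.trans (min_le_left _ _))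
  have h0 : (0 : ℝ) ∈ Icc (-(ε / 2)) (ε / 2) := ⟨by linarith, by linarith⟩
  have hsC : C * |s| ≤ 1 := by
    have := hsabs.trans (min_le_right _ _)
    rw [le_div_iff₀ (by positivity)] at this
    linarith
  have hsm : s ∈ Ioo (-ε) ε := ⟨by linarith [hs2.1], by linarith [hs2.2]⟩
  have hbd : ∀ t ∈ Icc a b, ∀ d, |H s t (κ d)| ≤ K * max |s| |κ d| := fun t ht d => by
    have := hK t ht 0 h0 s hs2 0 (by norm_num) (κ d) (hκm d)
    simpa [H0 t ht] using this
  -- The truncated field is bounded by `K * max (ε / 2) 1`; the spatial radius is this bound times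
  -- `b - a`, so the solution reaches `b`.
  have hpl : IsPicardLindelof (fun t d => H s t (κ d)) (⟨a, left_mem_Icc.2 hab⟩ : Icc a b) (0 : ℝ)
      (Real.toNNReal (K * max (ε / 2) 1 * (b - a))) 0 (Real.toNNReal (K * max (ε / 2) 1))
      (Real.toNNReal K) := by
    constructor
    · intro t ht
      refine LipschitzOnWith.of_dist_le_mul fun x _ y _ => ?_
      rw [Real.dist_eq, Real.dist_eq, Real.coe_toNNReal _ hK0]
      refine (hK t ht s hs2 s hs2 _ (hκm y) _ (hκm x)).trans ?_
      rw [sub_self, abs_zero, max_eq_right (abs_nonneg _)]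
      exact mul_le_mul_of_nonneg_left (hκl _ _) hK0
    · intro x _
      exact hHc.comp (f := fun t : ℝ => ((s, t), κ x)) (by fun_prop)
        (fun t ht => ⟨⟨hsm, ht⟩, mem_univ _⟩)
    · intro t ht x _
      rw [Real.coe_toNNReal _ (by positivity)]
      refine (hbd t ht x).trans (mul_le_mul_of_nonneg_left ?_ hK0)
      exact max_le_max (abs_le.2 hs2) (abs_le.2 (hκm x))
    · have h1 : 0 ≤ K * max (ε / 2) 1 := by positivity
      rw [Real.coe_toNNReal _ h1,
        Real.coe_toNNReal _ (mul_nonneg h1 (by linarith))]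
      simp [hab]
  obtain ⟨d, hd0, hd⟩ := hpl.exists_eq_forall_mem_Icc_hasDerivWithinAt₀
  replace hd0 : d a = 0 := hd0
  have hdb : ∀ t ∈ Icc a b, |d t| ≤ C * |s| := by
    intro t ht
    have := abs_le_mul_exp_of_abs_deriv_le (K := K) (η := K * |s|) hK1 (by positivity) hd hd0
      (fun t ht => by
        have h2 : |κ (d t)| ≤ |d t| := by simpa [hκ0] using hκl (d t) 0
        refine (hbd t ht (d t)).trans ?_
        rw [← mul_add]
        refine mul_le_mul_of_nonneg_left (max_le ?_ ?_) hK0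
        · linarith [abs_nonneg (d t)]
        · linarith [abs_nonneg s]) t ht
    calc _ ≤ _ := this
      _ = _ := by rw [hC]; ring
  refine ⟨d, ⟨hd0, fun t ht => ?_⟩, hdb⟩
  have := hd t ht
  rwa [hκid _ ((hdb t ht).trans hsC)] at this

/-- Differentiability at `s = 0` of the terminal value of the solutions of `d' = H s t d`,
`d a = 0`. -/
theorem hasDerivAt_of_solvesFromZero (hε : 0 < ε) (hab : a ≤ b)
    (hH : ∀ s ∈ Ioo (-ε) ε, ∀ t ∈ Icc a b, ∀ d,
      HasFDerivAt (fun q : ℝ × ℝ => H q.1 t q.2) (D s t d) (s, d))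
    (hDc : ContinuousOn (fun p : (ℝ × ℝ) × ℝ => D p.1.1 p.1.2 p.2)
      ((Ioo (-ε) ε ×ˢ Icc a b) ×ˢ univ))
    (hHc : ContinuousOn (fun p : (ℝ × ℝ) × ℝ => H p.1.1 p.1.2 p.2)
      ((Ioo (-ε) ε ×ˢ Icc a b) ×ˢ univ))
    (H0 : ∀ t ∈ Icc a b, H 0 t 0 = 0) {w : ℝ → ℝ}
    (hw : SolvesFromZero a b (fun t w => D 0 t 0 (1, 0) + D 0 t 0 (0, 1) * w) w)
    {d : ℝ → ℝ → ℝ} (hd : ∀ᶠ s in 𝓝 (0 : ℝ), SolvesFromZero a b (H s) (d s)) :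
    HasDerivAt (fun s => d s b) (w b) 0 := by
  obtain ⟨C, hC1, hC⟩ := exists_solvesFromZero hε hab hH hDc hHc H0
  have hdC : ∀ᶠ s in 𝓝 (0 : ℝ), ∀ t ∈ Icc a b, |d s t| ≤ C * |s| := by
    filter_upwards [hC, hd, Ioo_mem_nhds (neg_lt_zero.2 hε) hε] with s ⟨d', hd', hb⟩ hds hs t ht
    -- The family `d` is arbitrary; uniqueness transfers to it the bound of the constructed
    -- solutions.
    rw [solvesFromZero_unique hH hDc hs hds hd' ht]
    exact hb t ht
  have h0 : (0 : ℝ) ∈ Ioo (-ε) ε := ⟨by linarith, hε⟩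
  have hD0 : ContinuousOn (fun t => D 0 t 0) (Icc a b) :=
    hDc.comp (f := fun t : ℝ => ((0, t), 0)) (by fun_prop) (fun t ht => ⟨⟨h0, ht⟩, mem_univ _⟩)
  obtain ⟨K', hK'⟩ := isCompact_Icc.exists_bound_of_continuousOn hD0
  set K := max K' 1 with hKdef
  have hK1 : 1 ≤ K := le_max_right _ _
  have hKD : ∀ t ∈ Icc a b, |D 0 t 0 (0, 1)| ≤ K := fun t ht => by
    have := (D 0 t 0).le_opNorm (0, 1)
    simp only [Prod.norm_def, norm_zero, norm_one, zero_le_one, sup_of_le_right, mul_one] at this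
    exact this.trans ((hK' t ht).trans (le_max_left _ _))
  -- Continuity of `D` is made uniform in time by compactness of `[a, b]`.
  have hunif : ∀ η > 0, ∃ δ > 0, δ < ε ∧ ∀ t ∈ Icc a b, ∀ q ∈ Icc (-δ) δ ×ˢ Icc (-δ) δ,
      ‖D q.1 t q.2 - D 0 t 0‖ ≤ η := by
    intro η hη
    -- The memberships are repeated inside the statement because the compactness argument uses full
    -- neighbourhoods, whereas `D` is continuous only relative to the strip.
    have hev : ∀ᶠ q : ℝ × ℝ in 𝓝 ((0, 0) : ℝ × ℝ), ∀ t ∈ Icc a b, t ∈ Icc a b →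
        q.1 ∈ Ioo (-ε) ε → ‖D q.1 t q.2 - D 0 t 0‖ ≤ η := by
      refine isCompact_Icc.eventually_forall_of_forall_eventually fun t ht => ?_
      have hc1 : Tendsto (fun z : (ℝ × ℝ) × ℝ => D z.1.1 z.2 z.1.2)
          (𝓝[{z | z.1.1 ∈ Ioo (-ε) ε ∧ z.2 ∈ Icc a b}] ((0, 0), t)) (𝓝 (D 0 t 0)) := by
        refine (hDc ((0, t), 0) ⟨⟨h0, ht⟩, mem_univ _⟩).tendsto.comp
          (f := fun z : (ℝ × ℝ) × ℝ => ((z.1.1, z.2), z.1.2)) ?_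
        refine Continuous.continuousWithinAt (f := fun z : (ℝ × ℝ) × ℝ => ((z.1.1, z.2), z.1.2))
          (x := ((0, 0), t)) (by fun_prop) |>.tendsto_nhdsWithin ?_
        exact fun z hz => ⟨⟨hz.1, hz.2⟩, mem_univ _⟩
      have hc2 : Tendsto (fun z : (ℝ × ℝ) × ℝ => D 0 z.2 0)
          (𝓝[{z | z.1.1 ∈ Ioo (-ε) ε ∧ z.2 ∈ Icc a b}] ((0, 0), t)) (𝓝 (D 0 t 0)) := by
        refine (hD0 t ht).tendsto.comp (f := fun z : (ℝ × ℝ) × ℝ => z.2) ?_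
        exact continuous_snd.continuousWithinAt (x := (((0, 0), t) : (ℝ × ℝ) × ℝ))
          |>.tendsto_nhdsWithin fun z hz => hz.2
      have hc3 := (hc1.sub hc2).norm
      rw [sub_self, norm_zero] at hc3
      have := hc3.eventually (ge_mem_nhds hη)
      rw [eventually_nhdsWithin_iff] at this
      exact this.mono fun z hz h1 h2 => hz ⟨h2, h1⟩
    obtain ⟨δ, hδ0, hδ⟩ := Metric.eventually_nhds_iff_ball.1 hev
    have hm : 0 < min (δ / 2) (ε / 2) := lt_min (by linarith) (by linarith)
    refine ⟨min (δ / 2) (ε / 2), hm, (min_le_right _ _).trans_lt (by linarith),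
      fun t ht q hq => ?_⟩
    have hq1 : |q.1| ≤ min (δ / 2) (ε / 2) := abs_le.2 hq.1
    have hq2 : |q.2| ≤ min (δ / 2) (ε / 2) := abs_le.2 hq.2
    have h1 := min_le_left (δ / 2) (ε / 2)
    have h2 := min_le_right (δ / 2) (ε / 2)
    refine hδ q ?_ t ht ht (abs_lt.1 (by linarith))
    rw [Metric.mem_ball, dist_eq_norm, Prod.norm_def]
    exact max_lt (by simp; linarith) (by simp; linarith)
  have key : ∀ η > 0, ∀ᶠ s in 𝓝 (0 : ℝ),
      |d s b - s * w b| ≤ η * C * |s| * Real.exp (K * (b - a)) := by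
    intro η hη
    obtain ⟨δ, hδ0, hδε, hδ⟩ := hunif η hη
    have hδC : 0 < δ / C := by positivity
    filter_upwards [hd, hdC, Icc_mem_nhds (neg_lt_zero.2 hδC) hδC] with s hs hsC hsδ
    have hsδ' : C * |s| ≤ δ := by
      have := abs_le.2 hsδ
      rw [le_div_iff₀ (by positivity)] at this
      linarith
    have hsδ'' : |s| ≤ δ := by nlinarith [abs_nonneg s]
    -- Grönwall is applied to the error `d s - s w` of the linear approximation. Its derivative is
    -- the linear term in the error plus a Taylor remainder of size at most `η * C * |s|`.
    refine abs_le_mul_exp_of_abs_deriv_le (f := fun t => d s t - s * w t) (K := K)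
      (η := η * C * |s|) hK1 (by positivity)
      (fun t ht => (hs.2 t ht).sub ((hw.2 t ht).const_mul s)) (by simp [hs.1, hw.1])
      (fun t ht => ?_) b (right_mem_Icc.2 hab)
    have hrem := (convex_Icc (-δ) δ |>.prod
      (convex_Icc (-δ) δ)).norm_image_sub_le_of_norm_hasFDerivWithin_le'
      (f := fun q : ℝ × ℝ => H q.1 t q.2) (f' := fun q => D q.1 t q.2) (φ := D 0 t 0) (C := η)
      (fun q hq => (hH q.1 ⟨by linarith [hq.1.1], by linarith [hq.1.2]⟩ t ht
        q.2).hasFDerivWithinAt)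
      (fun q hq => hδ t ht q hq)
      (x := (0, 0)) (y := (s, d s t)) (by constructor <;> constructor <;> simp <;> linarith)
      ⟨abs_le.1 hsδ'', abs_le.1 ((hsC t ht).trans hsδ')⟩
    have hnorm : ‖((s, d s t) : ℝ × ℝ) - (0, 0)‖ ≤ C * |s| := by
      simp only [Prod.mk_sub_mk, sub_zero, Prod.norm_def, Real.norm_eq_abs]
      exact max_le (by nlinarith [abs_nonneg s]) (hsC t ht)
    have hlin : D 0 t 0 (((s, d s t) : ℝ × ℝ) - (0, 0))
        = s * D 0 t 0 (1, 0) + d s t * D 0 t 0 (0, 1) := by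
      rw [← smul_eq_mul, ← smul_eq_mul, ← map_smul, ← map_smul, ← map_add]
      simp
    rw [hlin, Real.norm_eq_abs] at hrem
    simp only [H0 t ht, sub_zero] at hrem
    have : H s t (d s t) - s * (D 0 t 0 (1, 0) + D 0 t 0 (0, 1) * w t)
        = D 0 t 0 (0, 1) * (d s t - s * w t) +
          (H s t (d s t) - (s * D 0 t 0 (1, 0) + d s t * D 0 t 0 (0, 1))) := by ring
    rw [this]
    refine (abs_add_le _ _).trans (add_le_add ?_ ?_)
    · rw [abs_mul]
      exact mul_le_mul_of_nonneg_right (hKD t ht) (abs_nonneg _)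
    · refine hrem.trans ?_
      rw [mul_assoc]
      exact mul_le_mul_of_nonneg_left hnorm hη.le
  have hd00 : d 0 b = 0 := by
    have := hdC.self_of_nhds b (right_mem_Icc.2 hab)
    simpa using this
  rw [hasDerivAt_iff_isLittleO_nhds_zero, Asymptotics.isLittleO_iff]
  intro η hη
  have hcpos : 0 < C * Real.exp (K * (b - a)) := by positivity
  filter_upwards [key (η / (C * Real.exp (K * (b - a)))) (by positivity)] with s hs
  simp only [zero_add, hd00, sub_zero, smul_eq_mul, Real.norm_eq_abs]
  refine hs.trans (le_of_eq ?_)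
  field_simp

end ParametricODE

/-! ### Charts and the tangent bundle -/

section Charts

variable {E : Type*} [NormedAddCommGroup E] [NormedSpace ℝ E]
  {Q : Type*} [TopologicalSpace Q] [ChartedSpace E Q]
  {F : Type*} [NormedAddCommGroup F] [NormedSpace ℝ F]

theorem contMDiffWithinAt_tangentBundle_mk {n : WithTop ℕ∞} {x w : F → E} {s : Set F} {p : F}
    (hx : ContDiffWithinAt ℝ n x s p) (hw : ContDiffWithinAt ℝ n w s p) :
    ContMDiffWithinAt 𝓘(ℝ, F) 𝓘(ℝ, E).tangent n
      (fun p => (⟨x p, w p⟩ : TangentBundle 𝓘(ℝ, E) E)) s p := by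
  apply Bundle.contMDiffWithinAt_totalSpace.2
  refine ⟨hx.contMDiffWithinAt, ?_⟩
  convert! hw.contMDiffWithinAt with y
  simp

variable {e : OpenPartialHomeomorph Q E}

/-- The differential of a chart, as an endomorphism of the model space. -/
def chartDiff (e : OpenPartialHomeomorph Q E) (q : Q) : E →L[ℝ] E :=
  mfderiv 𝓘(ℝ, E) 𝓘(ℝ, E) e q

theorem mdifferentiableAt_chart (he : e ∈ IsManifold.maximalAtlas 𝓘(ℝ, E) ∞ Q) {q : Q}
    (hq : q ∈ e.source) : MDifferentiableAt 𝓘(ℝ, E) 𝓘(ℝ, E) e q :=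
  (contMDiffAt_of_mem_maximalAtlas he hq).mdifferentiableAt (by simp)

theorem mdifferentiableAt_chart_symm (he : e ∈ IsManifold.maximalAtlas 𝓘(ℝ, E) ∞ Q) {x : E}
    (hx : x ∈ e.target) : MDifferentiableAt 𝓘(ℝ, E) 𝓘(ℝ, E) e.symm x :=
  (contMDiffAt_symm_of_mem_maximalAtlas he hx).mdifferentiableAt (by simp)

/-- The equality is stated in the total space because the two velocities lie in fibres over points
that are only propositionally equal. -/
theorem mk_velocity_congr {a b : ℝ} {γ γ' : ℝ → Q} (h : EqOn γ γ' (Icc a b)) {t : ℝ}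
    (ht : t ∈ Icc a b) :
    (⟨γ t, velocity a b γ t⟩ : TangentBundle 𝓘(ℝ, E) Q) = ⟨γ' t, velocity a b γ' t⟩ := by
  have h2 : mfderivWithin 𝓘(ℝ, ℝ) 𝓘(ℝ, E) γ (Icc a b) t
      = mfderivWithin 𝓘(ℝ, ℝ) 𝓘(ℝ, E) γ' (Icc a b) t := mfderivWithin_congr h (h ht)
  simp only [velocity]
  have h' : ∀ (q q' : Q) (u u' : E), q = q' → u = u' →
      (⟨q, u⟩ : TangentBundle 𝓘(ℝ, E) Q) = ⟨q', u'⟩ := by rintro _ _ _ _ rfl rfl; rfl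
  exact h' _ _ _ _ (h ht) (congrArg (fun A : ℝ →L[ℝ] E => A 1) h2)

theorem mfderiv_chart_symm_mfderiv_chart (he : e ∈ IsManifold.maximalAtlas 𝓘(ℝ, E) ∞ Q) {q : Q}
    (hq : q ∈ e.source) (u : E) :
    (mfderiv 𝓘(ℝ, E) 𝓘(ℝ, E) e.symm (e q) (chartDiff e q u) : E) = u := by
  have h := mfderiv_comp q (mdifferentiableAt_chart_symm he (e.map_source hq))
    (mdifferentiableAt_chart he hq)
  have h2 : mfderiv 𝓘(ℝ, E) 𝓘(ℝ, E) (e.symm ∘ e) q = mfderiv 𝓘(ℝ, E) 𝓘(ℝ, E) id q := by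
    apply Filter.EventuallyEq.mfderiv_eq
    filter_upwards [e.open_source.mem_nhds hq] with y hy using e.left_inv hy
  rw [h2, mfderiv_id] at h
  exact (congrArg (fun A : E →L[ℝ] E => A u) h).symm

theorem mk_chart_symm_eq (he : e ∈ IsManifold.maximalAtlas 𝓘(ℝ, E) ∞ Q) {q : Q}
    (hq : q ∈ e.source) (u : TangentSpace 𝓘(ℝ, E) q) :
    (⟨e.symm (e q), mfderiv 𝓘(ℝ, E) 𝓘(ℝ, E) e.symm (e q)
      (chartDiff e q u)⟩ : TangentBundle 𝓘(ℝ, E) Q) = ⟨q, u⟩ := by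
  have h : ∀ (q' : Q) (u' : E), q' = q → u' = u →
      (⟨q', u'⟩ : TangentBundle 𝓘(ℝ, E) Q) = ⟨q, u⟩ := by rintro _ _ rfl rfl; rfl
  exact h _ _ (e.left_inv hq) (mfderiv_chart_symm_mfderiv_chart he hq u)

theorem chartLagrangian_mfderiv (L : TangentBundle 𝓘(ℝ, E) Q × ℝ → ℝ)
    (he : e ∈ IsManifold.maximalAtlas 𝓘(ℝ, E) ∞ Q) {q : Q}
    (hq : q ∈ e.source) (u : TangentSpace 𝓘(ℝ, E) q) (z : ℝ) :
    chartLagrangian L e (e q) (chartDiff e q u) z = L (⟨q, u⟩, z) := by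
  exact congrArg (fun y => L (y, z)) (mk_chart_symm_eq he hq u)

theorem chartVelocity_eq (he : e ∈ IsManifold.maximalAtlas 𝓘(ℝ, E) ∞ Q) {a b t : ℝ}
    (hab : a < b) (ht : t ∈ Icc a b) {γ : ℝ → Q}
    (hγ : MDifferentiableWithinAt 𝓘(ℝ, ℝ) 𝓘(ℝ, E) γ (Icc a b) t) (hq : γ t ∈ e.source) :
    chartVelocity e a b γ t = chartDiff e (γ t) (velocity a b γ t) := by
  have h := mfderiv_comp_mfderivWithin t (mdifferentiableAt_chart he hq) hγ
    ((uniqueDiffOn_Icc hab).uniqueMDiffOn t ht)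
  rw [mfderivWithin_eq_fderivWithin] at h
  exact congrArg (fun A : ℝ →L[ℝ] E => A 1) h

variable [IsManifold 𝓘(ℝ, E) ∞ Q]

/-- Over the open target this is the tangent map of `e.symm` applied to `(x, w)`, and the tangent
map of a smooth map is smooth. -/
theorem contMDiffWithinAt_mfderiv_chart_symm (he : e ∈ IsManifold.maximalAtlas 𝓘(ℝ, E) ∞ Q)
    {x w : F → E} {s : Set F} {p : F}
    (hx : ContDiffWithinAt ℝ ∞ x s p) (hw : ContDiffWithinAt ℝ ∞ w s p) (hp : x p ∈ e.target) :
    ContMDiffWithinAt 𝓘(ℝ, F) 𝓘(ℝ, E).tangent ∞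
      (fun p => (⟨e.symm (x p), mfderiv 𝓘(ℝ, E) 𝓘(ℝ, E) e.symm (x p) (w p)⟩ :
        TangentBundle 𝓘(ℝ, E) Q)) s p := by
  have h1 := (contMDiffOn_symm_of_mem_maximalAtlas he).contMDiffOn_tangentMapWithin
    (m := ∞) (by simp) e.open_target.uniqueMDiffOn
  have h2 := (h1 ⟨x p, w p⟩ hp).contMDiffAt
    ((FiberBundle.continuous_proj E (TangentSpace 𝓘(ℝ, E))).continuousAt.preimage_mem_nhds
      (e.open_target.mem_nhds hp))
  have h3 := h2.comp_contMDiffWithinAt (f := fun p => (⟨x p, w p⟩ : TangentBundle 𝓘(ℝ, E) E)) p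
    (contMDiffWithinAt_tangentBundle_mk hx hw)
  have key : ∀ p, x p ∈ e.target →
      (⟨e.symm (x p), mfderiv 𝓘(ℝ, E) 𝓘(ℝ, E) e.symm (x p) (w p)⟩ : TangentBundle 𝓘(ℝ, E) Q)
      = tangentMapWithin 𝓘(ℝ, E) 𝓘(ℝ, E) e.symm e.target ⟨x p, w p⟩ := fun p hp => by
    simp only [tangentMapWithin]
    rw [mfderivWithin_of_isOpen e.open_target hp]
  refine h3.congr_of_eventuallyEq ?_ (key p hp)
  filter_upwards [hx.continuousWithinAt.preimage_mem_nhdsWithin (e.open_target.mem_nhds hp)]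
    with y hy using key y hy

theorem contDiffWithinAt_mfderiv_chart (he : e ∈ IsManifold.maximalAtlas 𝓘(ℝ, E) ∞ Q)
    {γ : F → TangentBundle 𝓘(ℝ, E) Q} {s : Set F} {p : F}
    (hγ : ContMDiffWithinAt 𝓘(ℝ, F) 𝓘(ℝ, E).tangent ∞ γ s p) (hp : (γ p).1 ∈ e.source) :
    ContDiffWithinAt ℝ ∞ (fun p => chartDiff e (γ p).1 (γ p).2) s p := by
  have h1 := (contMDiffOn_of_mem_maximalAtlas he).contMDiffOn_tangentMapWithin
    (m := ∞) (by simp) e.open_source.uniqueMDiffOn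
  have h2 := (h1 (γ p) hp).contMDiffAt
    ((FiberBundle.continuous_proj E (TangentSpace 𝓘(ℝ, E))).continuousAt.preimage_mem_nhds
      (e.open_source.mem_nhds hp))
  have h3 := ((contMDiff_snd_tangentBundle_modelSpace E 𝓘(ℝ, E)).contMDiffAt.comp _
    h2).comp_contMDiffWithinAt p hγ
  rw [← contMDiffWithinAt_iff_contDiffWithinAt]
  have key : ∀ p, (γ p).1 ∈ e.source → chartDiff e (γ p).1 (γ p).2 =
      (tangentMapWithin 𝓘(ℝ, E) 𝓘(ℝ, E) e e.source (γ p)).2 := fun p hp => by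
    simp only [tangentMapWithin]
    rw [mfderivWithin_of_isOpen e.open_source hp]
    rfl
  refine h3.congr_of_eventuallyEq ?_ (key p hp)
  have hc : ContinuousWithinAt (fun p => (γ p).1) s p :=
    (FiberBundle.continuous_proj E (TangentSpace 𝓘(ℝ, E))).continuousAt.comp_continuousWithinAt
      hγ.continuousWithinAt
  filter_upwards [hc.preimage_mem_nhdsWithin (e.open_source.mem_nhds hp)] with y hy using key y hy

theorem contDiffAt_chartLagrangian {L : TangentBundle 𝓘(ℝ, E) Q × ℝ → ℝ}
    (hL : ContMDiff (𝓘(ℝ, E).tangent.prod 𝓘(ℝ, ℝ)) 𝓘(ℝ, ℝ) ∞ L)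
    (he : e ∈ IsManifold.maximalAtlas 𝓘(ℝ, E) ∞ Q) {y : (E × E) × ℝ} (hy : y.1.1 ∈ e.target) :
    ContDiffAt ℝ ∞ (fun y : (E × E) × ℝ => chartLagrangian L e y.1.1 y.1.2 y.2) y := by
  have h1 := contMDiffWithinAt_mfderiv_chart_symm he (x := fun y : (E × E) × ℝ => y.1.1)
    (w := fun y : (E × E) × ℝ => y.1.2) (s := univ) (p := y)
    (by fun_prop) (by fun_prop) hy
  have h2 : ContMDiffWithinAt 𝓘(ℝ, (E × E) × ℝ) 𝓘(ℝ, ℝ) ∞ (fun y : (E × E) × ℝ => y.2) univ y :=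
    contDiff_snd.contMDiff.contMDiffAt.contMDiffWithinAt
  rw [← contMDiffAt_iff_contDiffAt, ← contMDiffWithinAt_univ]
  exact hL.contMDiffAt.comp_contMDiffWithinAt y (h1.prodMk h2)

end Charts

/-! ### Joint smoothness of velocities along a variation -/

section Variations

variable {E : Type*} [NormedAddCommGroup E] [NormedSpace ℝ E]
  {Q : Type*} [TopologicalSpace Q] [ChartedSpace E Q]
  {a b ε : ℝ} {c : ℝ → ℝ → Q}

theorem uniqueDiffOn_strip (hab : a < b) :
    UniqueDiffOn ℝ (Ioo (-ε) ε ×ˢ Icc a b) :=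
  isOpen_Ioo.uniqueDiffOn.prod (uniqueDiffOn_Icc hab)

theorem contDiffWithinAt_chart_variation {e : OpenPartialHomeomorph Q E}
    (he : e ∈ IsManifold.maximalAtlas 𝓘(ℝ, E) ∞ Q)
    (hc : ContMDiffOn 𝓘(ℝ, ℝ × ℝ) 𝓘(ℝ, E) ∞ (fun p : ℝ × ℝ => c p.1 p.2)
      (Ioo (-ε) ε ×ˢ Icc a b)) {p : ℝ × ℝ} (hp : p ∈ Ioo (-ε) ε ×ˢ Icc a b)
    (hq : c p.1 p.2 ∈ e.source) :
    ContDiffWithinAt ℝ ∞ (fun p : ℝ × ℝ => e (c p.1 p.2)) (Ioo (-ε) ε ×ˢ Icc a b) p := by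
  rw [← contMDiffWithinAt_iff_contDiffWithinAt]
  exact (contMDiffAt_of_mem_maximalAtlas he hq).comp_contMDiffWithinAt p (hc p hp)

/-- Reading the velocity as the derivative of the two-variable map in the direction `(0, 1)` gives
its joint smoothness in `(s, t)`. -/
theorem mk_velocity_eq_mfderivWithin (hab : a < b) {s t : ℝ} (hs : s ∈ Ioo (-ε) ε)
    (ht : t ∈ Icc a b)
    (hc : ContMDiffOn 𝓘(ℝ, ℝ × ℝ) 𝓘(ℝ, E) ∞ (fun p : ℝ × ℝ => c p.1 p.2)
      (Ioo (-ε) ε ×ˢ Icc a b)) :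
    velocity a b (c s) t = mfderivWithin 𝓘(ℝ, ℝ × ℝ) 𝓘(ℝ, E) (fun p : ℝ × ℝ => c p.1 p.2)
      (Ioo (-ε) ε ×ˢ Icc a b) (s, t) ((0, 1) : ℝ × ℝ) := by
  have hj : HasFDerivWithinAt (fun τ : ℝ => ((s, τ) : ℝ × ℝ))
      (ContinuousLinearMap.inr ℝ ℝ ℝ) (Icc a b) t := (hasFDerivAt_prodMk_right s t).hasFDerivWithinAt
  have h := mfderivWithin_comp (I := 𝓘(ℝ, ℝ)) (I' := 𝓘(ℝ, ℝ × ℝ)) (I'' := 𝓘(ℝ, E)) t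
    (f := fun τ : ℝ => ((s, τ) : ℝ × ℝ)) (g := fun p : ℝ × ℝ => c p.1 p.2) (s := Icc a b)
    (u := Ioo (-ε) ε ×ˢ Icc a b)
    ((hc (s, t) ⟨hs, ht⟩).mdifferentiableWithinAt (by simp))
    hj.differentiableWithinAt.mdifferentiableWithinAt (fun τ hτ => ⟨hs, hτ⟩)
    ((uniqueDiffOn_Icc hab).uniqueMDiffOn t ht)
  rw [mfderivWithin_eq_fderivWithin, hj.fderivWithin (uniqueDiffOn_Icc hab t ht)] at h
  exact congrArg (fun A : ℝ →L[ℝ] E => A 1) h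

variable [IsManifold 𝓘(ℝ, E) ∞ Q]

theorem contMDiffOn_mk_velocity (hab : a < b)
    (hc : ContMDiffOn 𝓘(ℝ, ℝ × ℝ) 𝓘(ℝ, E) ∞ (fun p : ℝ × ℝ => c p.1 p.2)
      (Ioo (-ε) ε ×ˢ Icc a b)) :
    ContMDiffOn 𝓘(ℝ, ℝ × ℝ) 𝓘(ℝ, E).tangent ∞
      (fun p : ℝ × ℝ => (⟨c p.1 p.2, velocity a b (c p.1) p.2⟩ : TangentBundle 𝓘(ℝ, E) Q))
      (Ioo (-ε) ε ×ˢ Icc a b) := by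
  have h1 := hc.contMDiffOn_tangentMapWithin (m := ∞) (by simp)
    (uniqueDiffOn_strip hab).uniqueMDiffOn
  have h2 : ContMDiffOn 𝓘(ℝ, ℝ × ℝ) 𝓘(ℝ, ℝ × ℝ).tangent ∞
      (fun p : ℝ × ℝ => (⟨p, ((0, 1) : ℝ × ℝ)⟩ : TangentBundle 𝓘(ℝ, ℝ × ℝ) (ℝ × ℝ)))
      (Ioo (-ε) ε ×ˢ Icc a b) := fun p _ =>
    contMDiffWithinAt_tangentBundle_mk contDiffWithinAt_id contDiffWithinAt_const
  refine (h1.comp h2 fun p hp => hp).congr fun p hp => ?_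
  rw [mk_velocity_eq_mfderivWithin hab hp.1 hp.2 hc]
  rfl

/-- The right-hand side of the Herglotz equation along the curves of a variation. -/
theorem contDiffOn_lagrangian_variation {L : TangentBundle 𝓘(ℝ, E) Q × ℝ → ℝ}
    (hL : ContMDiff (𝓘(ℝ, E).tangent.prod 𝓘(ℝ, ℝ)) 𝓘(ℝ, ℝ) ∞ L) (hab : a < b)
    (hc : ContMDiffOn 𝓘(ℝ, ℝ × ℝ) 𝓘(ℝ, E) ∞ (fun p : ℝ × ℝ => c p.1 p.2)
      (Ioo (-ε) ε ×ˢ Icc a b)) :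
    ContDiffOn ℝ ∞ (fun p : (ℝ × ℝ) × ℝ =>
      L (⟨c p.1.1 p.1.2, velocity a b (c p.1.1) p.1.2⟩, p.2))
      ((Ioo (-ε) ε ×ˢ Icc a b) ×ˢ univ) := by
  rw [← contMDiffOn_iff_contDiffOn]
  have h1 : ContMDiffOn 𝓘(ℝ, (ℝ × ℝ) × ℝ) 𝓘(ℝ, ℝ × ℝ) ∞ (Prod.fst : (ℝ × ℝ) × ℝ → ℝ × ℝ)
      ((Ioo (-ε) ε ×ˢ Icc a b) ×ˢ univ) := contDiff_fst.contMDiff.contMDiffOn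
  have h2 : ContMDiffOn 𝓘(ℝ, (ℝ × ℝ) × ℝ) 𝓘(ℝ, ℝ) ∞ (Prod.snd : (ℝ × ℝ) × ℝ → ℝ)
      ((Ioo (-ε) ε ×ˢ Icc a b) ×ˢ univ) := contDiff_snd.contMDiff.contMDiffOn
  exact hL.comp_contMDiffOn
    (((contMDiffOn_mk_velocity hab hc).comp h1 fun p hp => hp.1).prodMk h2)

end Variations

/-! ### The first variation in coordinates -/

section VectorSpace

variable {E : Type*} [NormedAddCommGroup E] [NormedSpace ℝ E] {ℓ : (E × E) × ℝ → ℝ}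
  {a b ε t : ℝ}

theorem hasFDerivAt_position {y : (E × E) × ℝ} (h : DifferentiableAt ℝ ℓ y) :
    HasFDerivAt (fun q => ℓ ((q, y.1.2), y.2))
      ((fderiv ℝ ℓ y).comp ((ContinuousLinearMap.inl ℝ (E × E) ℝ).comp
        (ContinuousLinearMap.inl ℝ E E))) y.1.1 :=
  HasFDerivAt.comp (g := ℓ) (f := fun q : E => ((q, y.1.2), y.2)) y.1.1 h.hasFDerivAt
    (HasFDerivAt.comp (g := fun p : E × E => (p, y.2)) (f := fun q : E => (q, y.1.2)) y.1.1
      (hasFDerivAt_prodMk_left y.1 y.2) (hasFDerivAt_prodMk_left y.1.1 y.1.2))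

theorem hasFDerivAt_velocity {y : (E × E) × ℝ} (h : DifferentiableAt ℝ ℓ y) :
    HasFDerivAt (fun w => ℓ ((y.1.1, w), y.2))
      ((fderiv ℝ ℓ y).comp ((ContinuousLinearMap.inl ℝ (E × E) ℝ).comp
        (ContinuousLinearMap.inr ℝ E E))) y.1.2 :=
  HasFDerivAt.comp (g := ℓ) (f := fun w : E => ((y.1.1, w), y.2)) y.1.2 h.hasFDerivAt
    (HasFDerivAt.comp (g := fun p : E × E => (p, y.2)) (f := fun w : E => (y.1.1, w)) y.1.2
      (hasFDerivAt_prodMk_left y.1 y.2) (hasFDerivAt_prodMk_right y.1.1 y.1.2))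

theorem contDiffWithinAt_derivWithin {G : Type*} [NormedAddCommGroup G] [NormedSpace ℝ G]
    {x : ℝ → G} {m n : WithTop ℕ∞} (hab : a < b) (ht : t ∈ Icc a b)
    (hx : ContDiffWithinAt ℝ n x (Icc a b) t) (hmn : m + 1 ≤ n) :
    ContDiffWithinAt ℝ m (derivWithin x (Icc a b)) (Icc a b) t :=
  (hx.fderivWithin_right (uniqueDiffOn_Icc hab) hmn ht).clm_apply contDiffWithinAt_const

section Curve

variable {x : ℝ → E} {z : ℝ → ℝ}

theorem eventually_differentiableAt (hab : a < b) (ht : t ∈ Icc a b)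
    (hx : ContDiffWithinAt ℝ ∞ x (Icc a b) t) (hz : ContinuousWithinAt z (Icc a b) t)
    (hℓ : ContDiffAt ℝ ∞ ℓ ((x t, derivWithin x (Icc a b) t), z t)) :
    ∀ᶠ τ in 𝓝[Icc a b] t, DifferentiableAt ℝ ℓ ((x τ, derivWithin x (Icc a b) τ), z τ) := by
  have hx' : ContDiffWithinAt ℝ 1 (derivWithin x (Icc a b)) (Icc a b) t :=
    contDiffWithinAt_derivWithin hab ht hx (by norm_cast)
  have hd : ∀ᶠ y in 𝓝 ((x t, derivWithin x (Icc a b) t), z t), DifferentiableAt ℝ ℓ y := by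
    filter_upwards [(hℓ.of_le (m := 1) (by norm_cast)).eventually (by simp)] with y hy
    exact hy.differentiableAt (by simp)
  exact ((hx.continuousWithinAt.prodMk hx'.continuousWithinAt).prodMk hz).eventually hd

/-- Only `C¹` regularity of `z` is assumed, so the composite is `C¹`; this suffices, since the
momentum is differentiated once. -/
theorem contDiffWithinAt_fderiv_curve (hab : a < b) (ht : t ∈ Icc a b)
    (hx : ContDiffWithinAt ℝ ∞ x (Icc a b) t) (hz : ContDiffWithinAt ℝ 1 z (Icc a b) t)
    (hℓ : ContDiffAt ℝ ∞ ℓ ((x t, derivWithin x (Icc a b) t), z t)) :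
    ContDiffWithinAt ℝ 1 (fun τ => fderiv ℝ ℓ ((x τ, derivWithin x (Icc a b) τ), z τ))
      (Icc a b) t := by
  have hx' : ContDiffWithinAt ℝ 1 (derivWithin x (Icc a b)) (Icc a b) t :=
    contDiffWithinAt_derivWithin hab ht hx (by norm_cast)
  have h1 : ContDiffAt ℝ 1 (fderiv ℝ ℓ) ((x t, derivWithin x (Icc a b) t), z t) :=
    hℓ.fderiv_right (by norm_cast)
  exact h1.comp_contDiffWithinAt (f := fun τ => ((x τ, derivWithin x (Icc a b) τ), z τ)) t
    (((hx.of_le (by norm_cast)).prodMk hx').prodMk hz)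

/-- The momentum `∂L/∂q̇` along a curve is continuously differentiable. -/
theorem contDiffWithinAt_momentum (hab : a < b) (ht : t ∈ Icc a b)
    (hx : ContDiffWithinAt ℝ ∞ x (Icc a b) t) (hz : ContDiffWithinAt ℝ 1 z (Icc a b) t)
    (hℓ : ContDiffAt ℝ ∞ ℓ ((x t, derivWithin x (Icc a b) t), z t)) :
    ContDiffWithinAt ℝ 1 (fun τ => fderiv ℝ (fun w => ℓ ((x τ, w), z τ))
      (derivWithin x (Icc a b) τ)) (Icc a b) t := by
  have h1 := (contDiffWithinAt_fderiv_curve hab ht hx hz hℓ).clm_comp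
    (contDiffWithinAt_const (c := (ContinuousLinearMap.inl ℝ (E × E) ℝ).comp
        (ContinuousLinearMap.inr ℝ E E)))
  have h2 := eventually_differentiableAt hab ht hx hz.continuousWithinAt hℓ
  refine h1.congr_of_eventuallyEq ?_ ?_
  · filter_upwards [h2] with τ hτ using (hasFDerivAt_velocity hτ).fderiv
  · exact (hasFDerivAt_velocity (h2.self_of_nhdsWithin ht)).fderiv

/-- The term `∂L/∂q` along a curve is continuous. -/
theorem continuousWithinAt_position (hab : a < b) (ht : t ∈ Icc a b)
    (hx : ContDiffWithinAt ℝ ∞ x (Icc a b) t) (hz : ContDiffWithinAt ℝ 1 z (Icc a b) t)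
    (hℓ : ContDiffAt ℝ ∞ ℓ ((x t, derivWithin x (Icc a b) t), z t)) :
    ContinuousWithinAt (fun τ =>
      fderiv ℝ (fun q => ℓ ((q, derivWithin x (Icc a b) τ), z τ)) (x τ)) (Icc a b) t := by
  have h2 := eventually_differentiableAt hab ht hx hz.continuousWithinAt hℓ
  refine ((contDiffWithinAt_fderiv_curve hab ht hx hz hℓ).continuousWithinAt.clm_comp
    (continuousWithinAt_const (b := (ContinuousLinearMap.inl ℝ (E × E) ℝ).comp
      (ContinuousLinearMap.inl ℝ E E)))).congr_of_eventuallyEq ?_ ?_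
  · filter_upwards [h2] with τ hτ using (hasFDerivAt_position hτ).fderiv
  · exact (hasFDerivAt_position (h2.self_of_nhdsWithin ht)).fderiv

end Curve

section Variation

variable {X : ℝ × ℝ → E} {z : ℝ → ℝ}

theorem slice_derivWithin (hab : a < b) {s : ℝ} (hs : s ∈ Ioo (-ε) ε)
    (ht : t ∈ Icc a b) (hX : DifferentiableWithinAt ℝ X (Ioo (-ε) ε ×ˢ Icc a b) (s, t)) :
    derivWithin (fun τ => X (s, τ)) (Icc a b) t
      = fderivWithin ℝ X (Ioo (-ε) ε ×ˢ Icc a b) (s, t) (0, 1) := by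
  have h := hX.hasFDerivWithinAt.comp (f := fun τ : ℝ => ((s, τ) : ℝ × ℝ)) (s := Icc a b) t
    (hasFDerivAt_prodMk_right s t).hasFDerivWithinAt (fun τ hτ => ⟨hs, hτ⟩)
  simpa [Function.comp_def] using h.hasDerivWithinAt.derivWithin (uniqueDiffOn_Icc hab t ht)

theorem slice_hasDerivAt {G : Type*} [NormedAddCommGroup G] [NormedSpace ℝ G] {X : ℝ × ℝ → G}
    {X' : (ℝ × ℝ) →L[ℝ] G} (hε : 0 < ε) (ht : t ∈ Icc a b)
    (hX : HasFDerivWithinAt X X' (Ioo (-ε) ε ×ˢ Icc a b) (0, t)) :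
    HasDerivAt (fun s => X (s, t)) (X' (1, 0)) 0 := by
  have h := hX.comp (f := fun s : ℝ => ((s, t) : ℝ × ℝ)) (s := Ioo (-ε) ε) 0
    (hasFDerivAt_prodMk_left (0 : ℝ) t).hasFDerivWithinAt (fun s hs => ⟨hs, ht⟩)
  have h2 := h.hasDerivWithinAt.hasDerivAt (Ioo_mem_nhds (neg_lt_zero.2 hε) hε)
  simpa [Function.comp_def] using h2

theorem slice_hasDerivWithinAt {G : Type*} [NormedAddCommGroup G] [NormedSpace ℝ G]
    {X : ℝ × ℝ → G} {X' : (ℝ × ℝ) →L[ℝ] G} (hε : 0 < ε)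
    (hX : HasFDerivWithinAt X X' (Ioo (-ε) ε ×ˢ Icc a b) (0, t)) :
    HasDerivWithinAt (fun τ => X (0, τ)) (X' (0, 1)) (Icc a b) t := by
  have h := hX.comp (f := fun τ : ℝ => ((0, τ) : ℝ × ℝ)) (s := Icc a b) t
    (hasFDerivAt_prodMk_right (0 : ℝ) t).hasFDerivWithinAt
    (fun τ hτ => ⟨⟨neg_lt_zero.2 hε, hε⟩, hτ⟩)
  simpa [Function.comp_def] using h.hasDerivWithinAt

theorem strip_subset_closure_interior (hab : a < b) {p : ℝ × ℝ}
    (hp : p ∈ Ioo (-ε) ε ×ˢ Icc a b) : p ∈ closure (interior (Ioo (-ε) ε ×ˢ Icc a b)) := by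
  rw [interior_prod_eq, closure_prod_eq, interior_Ioo, interior_Icc, closure_Ioo hab.ne]
  exact ⟨subset_closure hp.1, hp.2⟩

/-- The coordinate form of the first variation: with `P = ∂ℓ/∂q̇` along the base curve and
`V = ∂ₛX`, both `∂ₛ(ℓ(X, ∂ₜX, z))` and `d/dt (P V)` involve the same term `P (∂ₜV)`. -/
theorem first_variation_in_coordinates (hε : 0 < ε) (hab : a < b) (ht : t ∈ Icc a b)
    (hX : ContDiffWithinAt ℝ ∞ X (Ioo (-ε) ε ×ˢ Icc a b) (0, t))
    (hz : ContDiffWithinAt ℝ 1 z (Icc a b) t)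
    (hℓ : ContDiffAt ℝ ∞ ℓ ((X (0, t), derivWithin (fun τ => X (0, τ)) (Icc a b) t), z t)) :
    ∃ W : E,
      HasDerivAt (fun s => ℓ ((X (s, t), fderivWithin ℝ X (Ioo (-ε) ε ×ˢ Icc a b) (s, t) (0, 1)),
          z t))
        (fderiv ℝ (fun q => ℓ ((q, derivWithin (fun τ => X (0, τ)) (Icc a b) t), z t)) (X (0, t))
            (fderivWithin ℝ X (Ioo (-ε) ε ×ˢ Icc a b) (0, t) (1, 0))
          + fderiv ℝ (fun w => ℓ ((X (0, t), w), z t))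
              (derivWithin (fun τ => X (0, τ)) (Icc a b) t) W) 0 ∧
      HasDerivWithinAt (fun τ => fderiv ℝ (fun w => ℓ ((X (0, τ), w), z τ))
          (derivWithin (fun τ => X (0, τ)) (Icc a b) τ)
          (fderivWithin ℝ X (Ioo (-ε) ε ×ˢ Icc a b) (0, τ) (1, 0)))
        (derivWithin (fun τ => fderiv ℝ (fun w => ℓ ((X (0, τ), w), z τ))
            (derivWithin (fun τ => X (0, τ)) (Icc a b) τ)) (Icc a b) t
            (fderivWithin ℝ X (Ioo (-ε) ε ×ˢ Icc a b) (0, t) (1, 0))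
          + fderiv ℝ (fun w => ℓ ((X (0, t), w), z t))
              (derivWithin (fun τ => X (0, τ)) (Icc a b) t) W) (Icc a b) t := by
  set S := Ioo (-ε) ε ×ˢ Icc a b with hS
  have h0 : (0 : ℝ) ∈ Ioo (-ε) ε := ⟨neg_lt_zero.2 hε, hε⟩
  have hmem : ((0, t) : ℝ × ℝ) ∈ S := ⟨h0, ht⟩
  have hD : ContDiffWithinAt ℝ 1 (fderivWithin ℝ X S) S (0, t) :=
    hX.fderivWithin_right (uniqueDiffOn_strip hab) (by norm_cast) hmem
  have hD' := (hD.differentiableWithinAt (by simp)).hasFDerivWithinAt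
  have hX' := (hX.differentiableWithinAt (by simp)).hasFDerivWithinAt
  -- Mixed partial derivatives commute also at `t = a` and `t = b`, because points of the strip lie
  -- in the closure of its interior.
  have hsymm : fderivWithin ℝ (fderivWithin ℝ X S) S (0, t) (1, 0) (0, 1)
      = fderivWithin ℝ (fderivWithin ℝ X S) S (0, t) (0, 1) (1, 0) :=
    hX.isSymmSndFDerivWithinAt (by simp; norm_cast) (uniqueDiffOn_strip hab)
      (strip_subset_closure_interior hab hmem) hmem _ _
  have hvel := slice_derivWithin hab h0 ht (hX.differentiableWithinAt (by simp))
  have hℓd : DifferentiableAt ℝ ℓ ((X (0, t), derivWithin (fun τ => X (0, τ)) (Icc a b) t), z t) :=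
    hℓ.differentiableAt (by simp)
  -- The witness is the mixed second derivative: it is `∂ₛ` of the velocity in the first claim and,
  -- by symmetry, `∂ₜ` of the variation field in the second.
  refine ⟨fderivWithin ℝ (fderivWithin ℝ X S) S (0, t) (1, 0) (0, 1), ?_, ?_⟩
  · have h1 := slice_hasDerivAt hε ht hX'
    have h2 := (slice_hasDerivAt hε ht hD').clm_apply (hasDerivAt_const (0 : ℝ) ((0, 1) : ℝ × ℝ))
    have h3 := (h1.prodMk h2).prodMk (hasDerivAt_const (0 : ℝ) (z t))
    rw [hvel] at hℓd ⊢
    have h4 := hℓd.hasFDerivAt.comp_hasDerivAt (0 : ℝ) h3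
    refine h4.congr_deriv ?_
    rw [(hasFDerivAt_position hℓd).fderiv, (hasFDerivAt_velocity hℓd).fderiv]
    simp only [ContinuousLinearMap.comp_apply, ContinuousLinearMap.inl_apply,
      ContinuousLinearMap.inr_apply, map_zero, add_zero]
    rw [← map_add]
    simp
  · have hx : ContDiffWithinAt ℝ ∞ (fun τ => X (0, τ)) (Icc a b) t :=
      hX.comp (f := fun τ : ℝ => ((0, τ) : ℝ × ℝ)) t (by fun_prop) (fun τ hτ => ⟨h0, hτ⟩)
    have h1 := ((contDiffWithinAt_momentum hab ht hx hz hℓ).differentiableWithinAt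
      (by simp)).hasDerivWithinAt
    have h2 := (slice_hasDerivWithinAt hε hD').clm_apply
      (hasDerivWithinAt_const t (Icc a b) ((1, 0) : ℝ × ℝ))
    refine (h1.clm_apply h2).congr_deriv ?_
    rw [hsymm]
    simp

end Variation

end VectorSpace

/-! ### The momentum along a variation -/

section FirstVariation

variable {E : Type*} [NormedAddCommGroup E] [NormedSpace ℝ E]
  {Q : Type*} [TopologicalSpace Q] [ChartedSpace E Q]
  {L : TangentBundle 𝓘(ℝ, E) Q × ℝ → ℝ} {e : OpenPartialHomeomorph Q E}
  {a b ε t : ℝ} {q₁ q₂ : Q} {ξ : ℝ → Q} {v : (t : ℝ) → TangentSpace 𝓘(ℝ, E) (ξ t)}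
  {c : ℝ → ℝ → Q}

theorem isHerglotzSolution_herglotzZ (hZ : InActionDomain L a b ξ) :
    IsHerglotzSolution L a b ξ (herglotzZ L a b ξ) := by
  rw [herglotzZ, dif_pos hZ]
  exact hZ.choose_spec

theorem herglotzCovector_apply (u : TangentSpace 𝓘(ℝ, E) (ξ t)) :
    herglotzCovector L e a b ξ t u
      = partialPosition L e a b ξ t (chartDiff e (ξ t) u)
        - derivWithin (partialVelocity L e a b ξ) (Icc a b) t (chartDiff e (ξ t) u)
        + partialAction L a b ξ t * partialVelocity L e a b ξ t (chartDiff e (ξ t) u) := rfl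

/-- The momentum `∂L/∂q̇` along `(ξ, ξ̇, 𝒵(ξ))` paired with `v`, without reference to a chart. -/
def momentumPairing (L : TangentBundle 𝓘(ℝ, E) Q × ℝ → ℝ) (a b : ℝ) (ξ : ℝ → Q)
    (v : (t : ℝ) → TangentSpace 𝓘(ℝ, E) (ξ t)) (t : ℝ) : ℝ :=
  deriv (fun r : ℝ => L (⟨ξ t, velocity a b ξ t + r • v t⟩, herglotzZ L a b ξ t)) 0

theorem momentumPairing_eq_zero (h : v t = 0) : momentumPairing L a b ξ v t = 0 := by
  simp [momentumPairing, h]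

theorem chartDiff_variation (he : e ∈ IsManifold.maximalAtlas 𝓘(ℝ, E) ∞ Q) (hε : 0 < ε)
    (hc : ContMDiffOn 𝓘(ℝ, ℝ × ℝ) 𝓘(ℝ, E) ∞ (fun p : ℝ × ℝ => c p.1 p.2)
      (Ioo (-ε) ε ×ˢ Icc a b)) (ht : t ∈ Icc a b)
    (hv : (⟨c 0 t, mfderiv 𝓘(ℝ, ℝ) 𝓘(ℝ, E) (fun s => c s t) 0 (1 : ℝ)⟩ :
      TangentBundle 𝓘(ℝ, E) Q) = ⟨ξ t, v t⟩) (hq : ξ t ∈ e.source) :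
    fderivWithin ℝ (fun p : ℝ × ℝ => e (c p.1 p.2)) (Ioo (-ε) ε ×ˢ Icc a b) (0, t) (1, 0)
      = chartDiff e (ξ t) (v t) := by
  have h0 : (0 : ℝ) ∈ Ioo (-ε) ε := ⟨neg_lt_zero.2 hε, hε⟩
  have hbase : c 0 t = ξ t := congrArg (fun y : TangentBundle 𝓘(ℝ, E) Q => y.1) hv
  have hq' : c 0 t ∈ e.source := by rwa [hbase]
  have h1 := slice_hasDerivAt hε ht
    ((contDiffWithinAt_chart_variation he hc (p := (0, t)) ⟨h0, ht⟩ hq').differentiableWithinAt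
      (by simp)).hasFDerivWithinAt
  have hcs : MDifferentiableAt 𝓘(ℝ, ℝ) 𝓘(ℝ, E) (fun s => c s t) 0 := by
    have hj : ContMDiffOn 𝓘(ℝ, ℝ) 𝓘(ℝ, ℝ × ℝ) ∞ (fun s : ℝ => ((s, t) : ℝ × ℝ)) (Ioo (-ε) ε) :=
      (by fun_prop : ContDiff ℝ ∞ (fun s : ℝ => ((s, t) : ℝ × ℝ))).contMDiff.contMDiffOn
    exact ((hc.comp hj fun s hs => ⟨hs, ht⟩).contMDiffAt
      (Ioo_mem_nhds h0.1 h0.2)).mdifferentiableAt (by simp)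
  have h2 := mfderiv_comp (0 : ℝ) (f := fun s => c s t) (mdifferentiableAt_chart he hq') hcs
  rw [mfderiv_eq_fderiv] at h2
  have h3 : fderiv ℝ (fun s => e (c s t)) 0 1 = chartDiff e (c 0 t)
      (mfderiv 𝓘(ℝ, ℝ) 𝓘(ℝ, E) (fun s => c s t) 0 (1 : ℝ)) :=
    congrArg (fun A : ℝ →L[ℝ] E => A 1) h2
  have h4 := congrArg (fun y : TangentBundle 𝓘(ℝ, E) Q => chartDiff e y.1 y.2) hv
  rw [← h1.deriv]
  exact h3.trans h4

/-- The trivial variation of a path. -/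
theorem IsPath.contMDiffOn_const (hξ : IsPath (E := E) a b q₁ q₂ ξ) :
    ContMDiffOn 𝓘(ℝ, ℝ × ℝ) 𝓘(ℝ, E) ∞ (fun p : ℝ × ℝ => ξ p.2) (Ioo (-1) 1 ×ˢ Icc a b) :=
  hξ.smooth.comp (f := fun p : ℝ × ℝ => p.2) contDiff_snd.contMDiff.contMDiffOn fun _ hp => hp.2

variable [IsManifold 𝓘(ℝ, E) ∞ Q]

/-- Bootstrap: a solution is continuous, hence so is the right-hand side of its equation, hence the
solution is `C¹`. The constant variation makes the results on strips available for `ξ` itself. -/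
theorem contDiffOn_herglotzZ (hL : ContMDiff (𝓘(ℝ, E).tangent.prod 𝓘(ℝ, ℝ)) 𝓘(ℝ, ℝ) ∞ L)
    (hab : a < b) (hξ : IsPath (E := E) a b q₁ q₂ ξ) (hZ : InActionDomain L a b ξ) :
    ContDiffOn ℝ 1 (herglotzZ L a b ξ) (Icc a b) := by
  have hz := isHerglotzSolution_herglotzZ hZ
  have hzc : ContinuousOn (herglotzZ L a b ξ) (Icc a b) :=
    fun t ht => (hz.deriv_eq t ht).continuousWithinAt
  have hF := (contDiffOn_lagrangian_variation (ε := 1) (c := fun _ => ξ) hL hab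
    hξ.contMDiffOn_const).continuousOn
  have hg : ContinuousOn
      (fun t => L (⟨ξ t, velocity a b ξ t⟩, herglotzZ L a b ξ t)) (Icc a b) :=
    hF.comp (f := fun t => (((0, t), herglotzZ L a b ξ t) : (ℝ × ℝ) × ℝ))
      (by fun_prop) fun t ht => ⟨⟨by norm_num, ht⟩, mem_univ _⟩
  rw [contDiffOn_one_iff_derivWithin (uniqueDiffOn_Icc hab)]
  exact ⟨fun t ht => (hz.deriv_eq t ht).differentiableWithinAt, hg.congr fun t ht =>
    (hz.deriv_eq t ht).derivWithin (uniqueDiffOn_Icc hab t ht)⟩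

theorem continuousOn_partialAction
    (hL : ContMDiff (𝓘(ℝ, E).tangent.prod 𝓘(ℝ, ℝ)) 𝓘(ℝ, ℝ) ∞ L)
    (hab : a < b) (hξ : IsPath (E := E) a b q₁ q₂ ξ) (hZ : InActionDomain L a b ξ) :
    ContinuousOn (partialAction L a b ξ) (Icc a b) := by
  have hzc := (contDiffOn_herglotzZ hL hab hξ hZ).continuousOn
  have hF := contDiffOn_lagrangian_variation (ε := 1) (c := fun _ => ξ) hL hab
    hξ.contMDiffOn_const
  have hS : UniqueDiffOn ℝ ((Ioo (-1 : ℝ) 1 ×ˢ Icc a b) ×ˢ (univ : Set ℝ)) :=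
    (uniqueDiffOn_strip hab).prod uniqueDiffOn_univ
  have hmaps : MapsTo (fun t => (((0, t), herglotzZ L a b ξ t) : (ℝ × ℝ) × ℝ)) (Icc a b)
      ((Ioo (-1) 1 ×ˢ Icc a b) ×ˢ univ) := fun t ht => ⟨⟨by norm_num, ht⟩, mem_univ _⟩
  have hD := ((hF.continuousOn_fderivWithin hS (by simp)).comp
    (f := fun t => (((0, t), herglotzZ L a b ξ t) : (ℝ × ℝ) × ℝ)) (by fun_prop) hmaps).clm_apply
    (continuousOn_const (c := (((0, 0), 1) : (ℝ × ℝ) × ℝ)))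
  refine hD.congr fun t ht => ?_
  have h1 := ((hF _ (hmaps ht)).differentiableWithinAt (by simp)).hasFDerivWithinAt.comp
    (f := fun r : ℝ => (((0, t), r) : (ℝ × ℝ) × ℝ)) (s := univ) (herglotzZ L a b ξ t)
    (hasFDerivAt_prodMk_right ((0, t) : ℝ × ℝ) _).hasFDerivWithinAt
    (fun r _ => ⟨⟨by norm_num, ht⟩, mem_univ _⟩)
  have h2 := (hasFDerivWithinAt_univ.1 h1).hasDerivAt.deriv
  exact h2

/-- The evolution of the momentum along a variation: the Herglotz covector, computed in any chart,
measures the defect from the linearised Herglotz equation. -/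
theorem hasDerivWithinAt_momentumPairing
    (hL : ContMDiff (𝓘(ℝ, E).tangent.prod 𝓘(ℝ, ℝ)) 𝓘(ℝ, ℝ) ∞ L)
    (hab : a < b) (hξ : IsPath (E := E) a b q₁ q₂ ξ) (hZ : InActionDomain L a b ξ)
    (he : e ∈ IsManifold.maximalAtlas 𝓘(ℝ, E) ∞ Q) (hε : 0 < ε)
    (hc : ContMDiffOn 𝓘(ℝ, ℝ × ℝ) 𝓘(ℝ, E) ∞ (fun p : ℝ × ℝ => c p.1 p.2)
      (Ioo (-ε) ε ×ˢ Icc a b))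
    (hv : ∀ t ∈ Icc a b, (⟨c 0 t, mfderiv 𝓘(ℝ, ℝ) 𝓘(ℝ, E) (fun s => c s t) 0 (1 : ℝ)⟩ :
      TangentBundle 𝓘(ℝ, E) Q) = ⟨ξ t, v t⟩) (ht : t ∈ Icc a b) (hq : ξ t ∈ e.source) :
    HasDerivWithinAt (momentumPairing L a b ξ v)
      (deriv (fun s => L (⟨c s t, velocity a b (c s) t⟩, herglotzZ L a b ξ t)) 0
        + partialAction L a b ξ t * momentumPairing L a b ξ v t
        - herglotzCovector L e a b ξ t (v t)) (Icc a b) t := by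
  set z := herglotzZ L a b ξ with hzdef
  set S := Ioo (-ε) ε ×ˢ Icc a b with hS
  set X : ℝ × ℝ → E := fun p => e (c p.1 p.2) with hXdef
  set ℓ : (E × E) × ℝ → ℝ := fun y => chartLagrangian L e y.1.1 y.1.2 y.2 with hℓdef
  have h0 : (0 : ℝ) ∈ Ioo (-ε) ε := ⟨neg_lt_zero.2 hε, hε⟩
  have hbase : ∀ τ ∈ Icc a b, c 0 τ = ξ τ := fun τ hτ =>
    congrArg (fun y : TangentBundle 𝓘(ℝ, E) Q => y.1) (hv τ hτ)
  have hX0 : ∀ τ ∈ Icc a b, X (0, τ) = e (ξ τ) := fun τ hτ => by simp [hXdef, hbase τ hτ]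
  have hXv : ∀ τ ∈ Icc a b, derivWithin (fun τ => X (0, τ)) (Icc a b) τ
      = chartVelocity e a b ξ τ := fun τ hτ => derivWithin_congr hX0 (hX0 τ hτ)
  have hP : ∀ τ ∈ Icc a b, fderiv ℝ (fun w => ℓ ((X (0, τ), w), z τ))
      (derivWithin (fun τ => X (0, τ)) (Icc a b) τ) = partialVelocity L e a b ξ τ := by
    intro τ hτ
    rw [hXv τ hτ, hX0 τ hτ]
    rfl
  have hℓ : ∀ q ∈ e.source, ∀ w r, ContDiffAt ℝ ∞ ℓ ((e q, w), r) := fun q hq w r =>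
    contDiffAt_chartLagrangian hL he (e.map_source hq)
  have hqc : c 0 t ∈ e.source := by rwa [hbase t ht]
  have hX : ContDiffWithinAt ℝ ∞ X S (0, t) :=
    contDiffWithinAt_chart_variation he hc (p := (0, t)) ⟨h0, ht⟩ hqc
  have hV : ∀ τ ∈ Icc a b, ξ τ ∈ e.source →
      fderivWithin ℝ X S (0, τ) (1, 0) = chartDiff e (ξ τ) (v τ) := fun τ hτ hqτ =>
    chartDiff_variation he hε hc hτ (hv τ hτ) hqτ
  have hsrc : ∀ᶠ τ in 𝓝[Icc a b] t, ξ τ ∈ e.source :=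
    (hξ.smooth t ht).continuousWithinAt.preimage_mem_nhdsWithin (e.open_source.mem_nhds hq)
  -- On the fibre the chart acts linearly, so the chart-free pairing equals its coordinate
  -- expression at all times when `ξ` is in the source, and the coordinate derivative can be
  -- transferred.
  have hpair : ∀ τ ∈ Icc a b, ξ τ ∈ e.source → momentumPairing L a b ξ v τ
      = partialVelocity L e a b ξ τ (chartDiff e (ξ τ) (v τ)) := by
    intro τ hτ hqτ
    have h1 : (fun r : ℝ => L (⟨ξ τ, velocity a b ξ τ + r • v τ⟩, z τ)) = fun r : ℝ =>
        ℓ ((e (ξ τ), chartVelocity e a b ξ τ + r • chartDiff e (ξ τ) (v τ)), z τ) := by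
      funext r
      rw [← chartLagrangian_mfderiv L he hqτ, chartVelocity_eq he hab hτ
        ((hξ.smooth τ hτ).mdifferentiableWithinAt (by simp)) hqτ]
      simp only [hℓdef]
      congr 1
      exact ((chartDiff e (ξ τ)).map_add _ _).trans
        (congrArg _ ((chartDiff e (ξ τ)).map_smul r (v τ)))
    rw [momentumPairing, h1]
    have h2 := hasFDerivAt_velocity (ℓ := ℓ)
      (y := ((e (ξ τ), chartVelocity e a b ξ τ), z τ))
      ((hℓ _ hqτ _ _).differentiableAt (by simp))
    have h3 : HasDerivAt (fun r : ℝ => chartVelocity e a b ξ τ + r • chartDiff e (ξ τ) (v τ))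
        (chartDiff e (ξ τ) (v τ)) 0 := by
      simpa using ((hasDerivAt_id (0 : ℝ)).smul_const
        (chartDiff e (ξ τ) (v τ))).const_add (chartVelocity e a b ξ τ)
    have h4 := HasFDerivAt.comp_hasDerivAt_of_eq (0 : ℝ) h2.differentiableAt.hasFDerivAt h3
      (by simp)
    exact h4.deriv
  obtain ⟨W, hW1, hW2⟩ := first_variation_in_coordinates (ℓ := ℓ) hε hab ht hX
    (contDiffOn_herglotzZ hL hab hξ hZ t ht)
    (by rw [hX0 t ht]; exact hℓ _ hq _ _)
  -- For `s` near `0` the point `c s t` remains in the source of the chart, which is enough for the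
  -- derivative at `0`.
  have hF : deriv (fun s => L (⟨c s t, velocity a b (c s) t⟩, z t)) 0
      = deriv (fun s => ℓ ((X (s, t), fderivWithin ℝ X S (s, t) (0, 1)), z t)) 0 := by
    apply Filter.EventuallyEq.deriv_eq
    have hcs : ContinuousAt (fun s => c s t) 0 :=
      (hc.continuousOn.comp (f := fun s : ℝ => ((s, t) : ℝ × ℝ)) (s := Ioo (-ε) ε) (by fun_prop)
        (fun s hs => ⟨hs, ht⟩)).continuousAt (Ioo_mem_nhds h0.1 h0.2)
    filter_upwards [Ioo_mem_nhds h0.1 h0.2,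
      hcs.preimage_mem_nhds (e.open_source.mem_nhds hqc)] with s hs hqs
    have hst : ((s, t) : ℝ × ℝ) ∈ S := ⟨hs, ht⟩
    have hcst : MDifferentiableWithinAt 𝓘(ℝ, ℝ) 𝓘(ℝ, E) (c s) (Icc a b) t := by
      have hj : ContMDiffOn 𝓘(ℝ, ℝ) 𝓘(ℝ, ℝ × ℝ) ∞ (fun τ : ℝ => ((s, τ) : ℝ × ℝ)) (Icc a b) :=
        (by fun_prop : ContDiff ℝ ∞ (fun τ : ℝ => ((s, τ) : ℝ × ℝ))).contMDiff.contMDiffOn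
      exact ((hc.comp hj fun τ hτ => ⟨hs, hτ⟩) t ht).mdifferentiableWithinAt (by simp)
    rw [← chartLagrangian_mfderiv L he hqs, ← chartVelocity_eq he hab ht hcst hqs,
      ← slice_derivWithin hab hs ht
        ((contDiffWithinAt_chart_variation he hc hst hqs).differentiableWithinAt (by simp))]
    rfl
  have hW3 : HasDerivWithinAt (momentumPairing L a b ξ v) _ (Icc a b) t :=
    hW2.congr_of_eventuallyEq (by
      filter_upwards [hsrc, self_mem_nhdsWithin] with τ hqτ hτ
      rw [hP τ hτ, hV τ hτ hqτ, hpair τ hτ hqτ])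
      (by rw [hP t ht, hV t ht hq, hpair t ht hq])
  refine hW3.congr_deriv ?_
  rw [derivWithin_congr hP (hP t ht), hP t ht, hV t ht hq, hF, hW1.deriv, herglotzCovector_apply,
    hpair t ht hq, hP t ht, hV t ht hq, hXv t ht, hX0 t ht]
  simp only [partialPosition, hℓdef]
  ring

end FirstVariation

/-! ### The derivative of the action -/

section ActionDerivative

variable {E : Type*} [NormedAddCommGroup E] [NormedSpace ℝ E]
  {Q : Type*} [TopologicalSpace Q] [ChartedSpace E Q] [IsManifold 𝓘(ℝ, E) ∞ Q]
  {L : TangentBundle 𝓘(ℝ, E) Q × ℝ → ℝ} {a b : ℝ} {q₁ q₂ : Q} {ξ : ℝ → Q}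
  {v : (t : ℝ) → TangentSpace 𝓘(ℝ, E) (ξ t)} {c : ℝ → ℝ → Q}

/-- The derivative of the action along a variation is the terminal value of the solution of the
linearised Herglotz equation. -/
theorem hasDerivAt_action_variation
    (hL : ContMDiff (𝓘(ℝ, E).tangent.prod 𝓘(ℝ, ℝ)) 𝓘(ℝ, ℝ) ∞ L)
    (hab : a < b) (hξ : IsPath (E := E) a b q₁ q₂ ξ) (hZ : InActionDomain L a b ξ)
    (hc : IsVariation a b q₁ q₂ ξ v c) :
    ∃ w : ℝ → ℝ, w a = 0 ∧ (∀ t ∈ Icc a b, HasDerivWithinAt w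
      (deriv (fun s => L (⟨c s t, velocity a b (c s) t⟩, herglotzZ L a b ξ t)) 0
        + partialAction L a b ξ t * w t) (Icc a b) t) ∧
      HasDerivAt (fun s => action L a b (c s)) (w b) 0 := by
  obtain ⟨⟨ε, hε, hcs, -⟩, hbase, -⟩ := hc
  have h0 : (0 : ℝ) ∈ Ioo (-ε) ε := ⟨neg_lt_zero.2 hε, hε⟩
  set z := herglotzZ L a b ξ with hzdef
  have hz : IsHerglotzSolution L a b ξ z := isHerglotzSolution_herglotzZ hZ
  have hzc : ContinuousOn z (Icc a b) := (contDiffOn_herglotzZ hL hab hξ hZ).continuousOn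
  set F : (ℝ × ℝ) × ℝ → ℝ := fun p =>
    L (⟨c p.1.1 p.1.2, velocity a b (c p.1.1) p.1.2⟩, p.2) with hFdef
  set S' : Set ((ℝ × ℝ) × ℝ) := (Ioo (-ε) ε ×ˢ Icc a b) ×ˢ univ with hS'
  have hF : ContDiffOn ℝ ∞ F S' := contDiffOn_lagrangian_variation hL hab hcs
  have hF0 : ∀ t ∈ Icc a b, ∀ r, F ((0, t), r) = L (⟨ξ t, velocity a b ξ t⟩, r) :=
    fun t ht r => congrArg (fun y => L (y, r)) (mk_velocity_congr hbase ht)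
  have hS'u : UniqueDiffOn ℝ S' := (uniqueDiffOn_strip hab).prod uniqueDiffOn_univ
  set j : (ℝ × ℝ) →L[ℝ] ((ℝ × ℝ) × ℝ) :=
    ((ContinuousLinearMap.inl ℝ ℝ ℝ).comp (ContinuousLinearMap.fst ℝ ℝ ℝ)).prod
      (ContinuousLinearMap.snd ℝ ℝ ℝ) with hj
  -- Subtracting `z` gives the difference `d = z' - z` the equation `d' = H s t d`, `d a = 0`, whose
  -- solution at `s = 0` is zero.
  set H : ℝ → ℝ → ℝ → ℝ := fun s t d => F ((s, t), z t + d) - F ((0, t), z t) with hHdef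
  set D : ℝ → ℝ → ℝ → ((ℝ × ℝ) →L[ℝ] ℝ) := fun s t d =>
    (fderivWithin ℝ F S' ((s, t), z t + d)).comp j with hDdef
  have hmaps : MapsTo (fun p : (ℝ × ℝ) × ℝ => (((p.1.1, p.1.2), z p.1.2 + p.2) : (ℝ × ℝ) × ℝ))
      S' S' := fun p hp => ⟨hp.1, mem_univ _⟩
  have hzc' : ContinuousOn (fun p : (ℝ × ℝ) × ℝ => z p.1.2) S' :=
    hzc.comp (f := fun p : (ℝ × ℝ) × ℝ => p.1.2) (by fun_prop) fun p hp => hp.1.2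
  have hshift : ContinuousOn
      (fun p : (ℝ × ℝ) × ℝ => (((p.1.1, p.1.2), z p.1.2 + p.2) : (ℝ × ℝ) × ℝ)) S' :=
    continuousOn_fst.prodMk (hzc'.add continuousOn_snd)
  have hH : ∀ s ∈ Ioo (-ε) ε, ∀ t ∈ Icc a b, ∀ d,
      HasFDerivAt (fun q : ℝ × ℝ => H q.1 t q.2) (D s t d) (s, d) := by
    intro s hs t ht d
    have h1 : HasFDerivAt (fun q : ℝ × ℝ => (((q.1, t), z t + q.2) : (ℝ × ℝ) × ℝ)) j (s, d) := by
      have := (j.hasFDerivAt (x := (s, d))).add_const (((0, t), z t) : (ℝ × ℝ) × ℝ)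
      refine this.congr_of_eventuallyEq (Eventually.of_forall fun q => ?_)
      simp [hj, add_comm]
    have h2 := ((hF ((s, t), z t + d) ⟨⟨hs, ht⟩, mem_univ _⟩).differentiableWithinAt
      (by simp)).hasFDerivWithinAt
    have h3 := h2.comp (f := fun q : ℝ × ℝ => (((q.1, t), z t + q.2) : (ℝ × ℝ) × ℝ))
      (s := Ioo (-ε) ε ×ˢ univ) (s, d) h1.hasFDerivWithinAt
      (fun q hq => ⟨⟨hq.1, ht⟩, mem_univ _⟩)
    exact (h3.hasFDerivAt (prod_mem_nhds (Ioo_mem_nhds hs.1 hs.2) univ_mem)).sub_const _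
  have hDc : ContinuousOn (fun p : (ℝ × ℝ) × ℝ => D p.1.1 p.1.2 p.2) S' :=
    (((hF.continuousOn_fderivWithin hS'u (by simp)).comp hshift hmaps).clm_comp
      continuousOn_const)
  have hHc : ContinuousOn (fun p : (ℝ × ℝ) × ℝ => H p.1.1 p.1.2 p.2) S' := by
    refine (hF.continuousOn.comp hshift hmaps).sub
      (hF.continuousOn.comp (f := fun p : (ℝ × ℝ) × ℝ => (((0, p.1.2), z p.1.2) : (ℝ × ℝ) × ℝ))
        ((by fun_prop : ContinuousOn (fun p : (ℝ × ℝ) × ℝ => ((0, p.1.2) : ℝ × ℝ)) S').prodMk hzc')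
        fun p hp => ⟨⟨h0, hp.1.2⟩, mem_univ _⟩)
  have H0 : ∀ t ∈ Icc a b, H 0 t 0 = 0 := fun t _ => by simp [hHdef]
  have hD0 : ContinuousOn (fun t => D 0 t 0) (Icc a b) :=
    hDc.comp (f := fun t : ℝ => (((0, t), 0) : (ℝ × ℝ) × ℝ)) (by fun_prop)
      fun t ht => ⟨⟨h0, ht⟩, mem_univ _⟩
  obtain ⟨w, hwa, hw⟩ := exists_linear_ode_solution hab.le
    (hD0.clm_apply (continuousOn_const (c := ((0, 1) : ℝ × ℝ))))
    (hD0.clm_apply (continuousOn_const (c := ((1, 0) : ℝ × ℝ))))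
  have hDs : ∀ t ∈ Icc a b, deriv (fun s => F ((s, t), z t)) 0 = D 0 t 0 (1, 0) := by
    intro t ht
    have h1 : HasDerivAt (fun s : ℝ => ((s, 0) : ℝ × ℝ)) (1, 0) 0 :=
      (hasDerivAt_id _).prodMk (hasDerivAt_const _ _)
    have := HasFDerivAt.comp_hasDerivAt_of_eq (0 : ℝ) (hH 0 h0 t ht 0) h1 rfl
    simpa [hHdef, Function.comp_def] using (this.add_const (F ((0, t), z t))).deriv
  have hDz : ∀ t ∈ Icc a b, partialAction L a b ξ t = D 0 t 0 (0, 1) := by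
    intro t ht
    have h1 : HasDerivAt (fun r => ((0, r - z t) : ℝ × ℝ)) (0, 1) (z t) :=
      (hasDerivAt_const _ _).prodMk ((hasDerivAt_id _).sub_const _)
    have h2 := HasFDerivAt.comp_hasDerivAt_of_eq (z t) (hH 0 h0 t ht 0) h1 (by simp)
    have h3 := (h2.add_const (F ((0, t), z t))).deriv
    simp only [hHdef, Function.comp_def, add_sub_cancel, sub_add_cancel, hF0 t ht] at h3
    exact h3
  have hsol : ∀ s ∈ Ioo (-ε) ε, ∀ z' : ℝ → ℝ, IsHerglotzSolution L a b (c s) z' ↔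
      SolvesFromZero a b (H s) (fun t => z' t - z t) := by
    intro s hs z'
    constructor
    · refine fun h => ⟨by simp [h.initial, hz.initial], fun t ht => ?_⟩
      refine ((h.deriv_eq t ht).sub (hz.deriv_eq t ht)).congr_deriv ?_
      simp only [hHdef, add_sub_cancel, hF0 t ht]
      rfl
    · rintro ⟨h1, h2⟩
      refine ⟨by simpa [hz.initial] using h1, fun t ht => ?_⟩
      have h3 := (h2 t ht).add (hz.deriv_eq t ht)
      have h4 : HasDerivWithinAt z' _ (Icc a b) t :=
        h3.congr_of_mem (fun t _ => by simp) ht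
      refine h4.congr_deriv ?_
      simp only [hHdef, add_sub_cancel, hF0 t ht, sub_add_cancel]
      rfl
  obtain ⟨C, -, hC⟩ := exists_solvesFromZero hε hab.le hH hDc hHc H0
  -- Curves with small `s` lie in the domain of the action, so `herglotzZ` is a genuine solution
  -- there and not the default value.
  have hd : ∀ᶠ s in 𝓝 (0 : ℝ),
      SolvesFromZero a b (H s) (fun t => herglotzZ L a b (c s) t - z t) := by
    filter_upwards [hC, Ioo_mem_nhds h0.1 h0.2] with s ⟨d, hd, _⟩ hs
    refine (hsol s hs _).1 (isHerglotzSolution_herglotzZ ⟨fun t => d t + z t, ?_⟩)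
    exact (hsol s hs _).2 (by simpa using hd)
  have hmain := hasDerivAt_of_solvesFromZero hε hab.le hH hDc hHc H0 ⟨hwa, hw⟩ hd
  refine ⟨w, hwa, fun t ht => ?_, ?_⟩
  · refine (hw t ht).congr_deriv ?_
    rw [← hDs t ht, ← hDz t ht]
  · simpa [action] using hmain.add_const (z b)

/-- The first variation formula: the Herglotz covector, computed at each time in an arbitrary
chart, is the source of a linear equation whose terminal value is the derivative of the action. -/
theorem first_variation_formula
    (hL : ContMDiff (𝓘(ℝ, E).tangent.prod 𝓘(ℝ, ℝ)) 𝓘(ℝ, ℝ) ∞ L)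
    (hab : a < b) (hξ : IsPath (E := E) a b q₁ q₂ ξ) (hZ : InActionDomain L a b ξ)
    {e : ℝ → OpenPartialHomeomorph Q E}
    (he : ∀ t ∈ Icc a b, e t ∈ IsManifold.maximalAtlas 𝓘(ℝ, E) ∞ Q ∧ ξ t ∈ (e t).source)
    (hva : v a = 0) (hvb : v b = 0) (hc : IsVariation a b q₁ q₂ ξ v c) :
    ∃ y : ℝ → ℝ, y a = 0 ∧ (∀ t ∈ Icc a b, HasDerivWithinAt y
      (herglotzCovector L (e t) a b ξ t (v t) + partialAction L a b ξ t * y t) (Icc a b) t) ∧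
      HasDerivAt (fun s => action L a b (c s)) (y b) 0 := by
  obtain ⟨w, hwa, hw, hwb⟩ := hasDerivAt_action_variation hL hab hξ hZ hc
  obtain ⟨⟨ε, hε, hcs, -⟩, -, hcv⟩ := hc
  -- The sources of the two equations differ exactly by the Herglotz covector applied to `v`.
  refine ⟨fun t => w t - momentumPairing L a b ξ v t,
    by simp [hwa, momentumPairing_eq_zero hva], fun t ht => ?_,
    by simpa [momentumPairing_eq_zero hvb] using hwb⟩
  refine ((hw t ht).sub (hasDerivWithinAt_momentumPairing hL hab hξ hZ (he t ht).1 hε hcs hcv ht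
    (he t ht).2)).congr_deriv ?_
  ring

end ActionDerivative

/-! ### Variations supported in a single chart -/

section Localized

variable {E : Type*} [NormedAddCommGroup E] [NormedSpace ℝ E]
  {Q : Type*} [TopologicalSpace Q] [ChartedSpace E Q]
  {L : TangentBundle 𝓘(ℝ, E) Q × ℝ → ℝ} {a b : ℝ} {q₁ q₂ : Q} {ξ : ℝ → Q}
  {e : OpenPartialHomeomorph Q E} {U : Set Q} {X : (q : Q) → TangentSpace 𝓘(ℝ, E) q} {φ : ℝ → ℝ}
  {t : ℝ}

theorem contDiffWithinAt_chart_curve (hξ : IsPath (E := E) a b q₁ q₂ ξ)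
    (he : e ∈ IsManifold.maximalAtlas 𝓘(ℝ, E) ∞ Q) (ht : t ∈ Icc a b) (hq : ξ t ∈ e.source) :
    ContDiffWithinAt ℝ ∞ (fun τ => e (ξ τ)) (Icc a b) t := by
  rw [← contMDiffWithinAt_iff_contDiffWithinAt]
  exact (contMDiffAt_of_mem_maximalAtlas he hq).comp_contMDiffWithinAt t (hξ.smooth t ht)

variable [IsManifold 𝓘(ℝ, E) ∞ Q]

theorem contDiffWithinAt_chart_field (hξ : IsPath (E := E) a b q₁ q₂ ξ)
    (he : e ∈ IsManifold.maximalAtlas 𝓘(ℝ, E) ∞ Q) (hU : IsOpen U)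
    (hX : ContMDiffOn 𝓘(ℝ, E) 𝓘(ℝ, E).tangent ∞
      (fun q => (⟨q, X q⟩ : TangentBundle 𝓘(ℝ, E) Q)) U)
    (ht : t ∈ Icc a b) (hq : ξ t ∈ e.source) (hqU : ξ t ∈ U) :
    ContDiffWithinAt ℝ ∞ (fun τ => chartDiff e (ξ τ) (X (ξ τ))) (Icc a b) t :=
  contDiffWithinAt_mfderiv_chart he (γ := fun τ => (⟨ξ τ, X (ξ τ)⟩ : TangentBundle 𝓘(ℝ, E) Q))
    ((hX.contMDiffAt (hU.mem_nhds hqU)).comp_contMDiffWithinAt t (hξ.smooth t ht)) hq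

theorem isInfinitesimalVariation_localized (hξ : IsPath (E := E) a b q₁ q₂ ξ)
    (he : e ∈ IsManifold.maximalAtlas 𝓘(ℝ, E) ∞ Q) (hU : IsOpen U)
    (hX : ContMDiffOn 𝓘(ℝ, E) 𝓘(ℝ, E).tangent ∞
      (fun q => (⟨q, X q⟩ : TangentBundle 𝓘(ℝ, E) Q)) U)
    (hφ : ContDiff ℝ ∞ φ) (hφs : tsupport φ ⊆ Ioo a b)
    (hsrc : ∀ t ∈ tsupport φ, ξ t ∈ e.source ∩ U) :
    IsInfinitesimalVariation a b ξ (fun t => φ t • X (ξ t)) := by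
  have h0 : ∀ t, t ∉ tsupport φ → φ t • X (ξ t) = 0 := fun t ht => by
    rw [image_eq_zero_of_notMem_tsupport ht, zero_smul]
  refine ⟨fun t ht => ?_, h0 a fun h => lt_irrefl _ (hφs h).1, h0 b fun h => lt_irrefl _ (hφs h).2⟩
  -- On the support the field is smooth in the chart; off it, the complement is open and the field
  -- is locally the zero section along `ξ`.
  by_cases hts : t ∈ tsupport φ
  · obtain ⟨hq, hqU⟩ := hsrc t hts
    have hx := contDiffWithinAt_chart_curve hξ he ht hq
    have h1 := contMDiffWithinAt_mfderiv_chart_symm he hx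
      (hφ.contDiffAt.contDiffWithinAt.smul (contDiffWithinAt_chart_field hξ he hU hX ht hq hqU))
      (e.map_source hq)
    have key : ∀ τ, ξ τ ∈ e.source → (⟨ξ τ, φ τ • X (ξ τ)⟩ : TangentBundle 𝓘(ℝ, E) Q) =
        ⟨e.symm (e (ξ τ)), mfderiv 𝓘(ℝ, E) 𝓘(ℝ, E) e.symm (e (ξ τ))
          (φ τ • chartDiff e (ξ τ) (X (ξ τ)) : E)⟩ := fun τ hτ => by
      rw [← mk_chart_symm_eq he hτ]
      have : chartDiff e (ξ τ) (φ τ • X (ξ τ)) = φ τ • chartDiff e (ξ τ) (X (ξ τ)) :=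
        (chartDiff e (ξ τ)).map_smul _ _
      rw [this]
    refine h1.congr_of_eventuallyEq ?_ (key t hq)
    filter_upwards [(hξ.smooth t ht).continuousWithinAt.preimage_mem_nhdsWithin
      (e.open_source.mem_nhds hq)] with τ hτ using key τ hτ
  · have h1 := (Bundle.contMDiff_zeroSection ℝ (TangentSpace 𝓘(ℝ, E) : Q → Type _)
      (IB := 𝓘(ℝ, E)) (F := E) (n := ∞)).contMDiffAt.comp_contMDiffWithinAt t (hξ.smooth t ht)
    refine h1.congr_of_eventuallyEq ?_ ?_
    · filter_upwards [mem_nhdsWithin_of_mem_nhds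
        ((isClosed_tsupport φ).isOpen_compl.mem_nhds hts)] with τ hτ
      rw [h0 τ hτ]
      rfl
    · rw [h0 t hts]
      rfl

open Classical in
/-- The variation `s ↦ e⁻¹(e(ξ) + s φ X(ξ))` of `ξ`, where `φ` is supported in the domain of the
chart `e`. -/
def localizedVariation (e : OpenPartialHomeomorph Q E) (φ : ℝ → ℝ)
    (X : (q : Q) → TangentSpace 𝓘(ℝ, E) q) (ξ : ℝ → Q) (s t : ℝ) : Q :=
  if t ∈ tsupport φ then e.symm (e (ξ t) + s • φ t • chartDiff e (ξ t) (X (ξ t))) else ξ t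

theorem isVariation_localized (hξ : IsPath (E := E) a b q₁ q₂ ξ)
    (he : e ∈ IsManifold.maximalAtlas 𝓘(ℝ, E) ∞ Q) (hU : IsOpen U)
    (hX : ContMDiffOn 𝓘(ℝ, E) 𝓘(ℝ, E).tangent ∞
      (fun q => (⟨q, X q⟩ : TangentBundle 𝓘(ℝ, E) Q)) U)
    (hφ : ContDiff ℝ ∞ φ) (hφc : HasCompactSupport φ) (hφs : tsupport φ ⊆ Ioo a b)
    (hsrc : ∀ t ∈ tsupport φ, ξ t ∈ e.source ∩ U) :
    IsVariation a b q₁ q₂ ξ (fun t => φ t • X (ξ t)) (localizedVariation e φ X ξ) := by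
  set Y : ℝ → E := fun t => φ t • chartDiff e (ξ t) (X (ξ t)) with hY
  have hx : ∀ t ∈ Icc a b, ξ t ∈ e.source → ContDiffWithinAt ℝ ∞ (fun τ => e (ξ τ)) (Icc a b) t :=
    fun t ht hq => contDiffWithinAt_chart_curve hξ he ht hq
  have hYs : ∀ t ∈ tsupport φ, ContDiffWithinAt ℝ ∞ Y (Icc a b) t := fun t ht =>
    hφ.contDiffAt.contDiffWithinAt.smul (contDiffWithinAt_chart_field hξ he hU hX
      (Ioo_subset_Icc_self (hφs ht)) (hsrc t ht).1 (hsrc t ht).2)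
  have hnot : ∀ s t, t ∉ tsupport φ → localizedVariation e φ X ξ s t = ξ t :=
    fun s t ht => if_neg ht
  -- The two branches of the definition agree wherever `ξ t` is in the source, so the chart formula
  -- holds in a relative neighbourhood of each point of the support.
  have hin : ∀ s t, ξ t ∈ e.source →
      localizedVariation e φ X ξ s t = e.symm (e (ξ t) + s • Y t) := by
    intro s t hq
    by_cases ht : t ∈ tsupport φ
    · exact if_pos ht
    · rw [hnot s t ht, hY]
      simp [image_eq_zero_of_notMem_tsupport ht, e.left_inv hq]
  -- Compactness of the support gives one range of `s` for which all displaced points stay in the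
  -- target.
  have htgt : ∀ᶠ s in 𝓝 (0 : ℝ), ∀ t ∈ tsupport φ, e (ξ t) + s • Y t ∈ e.target := by
    refine hφc.isCompact.eventually_forall_of_forall_eventually fun t ht => ?_
    have hnhds : Icc a b ∈ 𝓝 t := Icc_mem_nhds (hφs ht).1 (hφs ht).2
    have h1 := ((hx t (mem_of_mem_nhds hnhds) (hsrc t ht).1).contDiffAt hnhds).continuousAt
    have h2 := ((hYs t ht).contDiffAt hnhds).continuousAt
    have h3 : ContinuousAt (fun p : ℝ × ℝ => e (ξ p.2) + p.1 • Y p.2) (0, t) :=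
      (ContinuousAt.comp (f := Prod.snd) (x := ((0, t) : ℝ × ℝ)) h1 continuousAt_snd).add
        (continuousAt_fst.smul
          (ContinuousAt.comp (f := Prod.snd) (x := ((0, t) : ℝ × ℝ)) h2 continuousAt_snd))
    refine h3.preimage_mem_nhds (e.open_target.mem_nhds ?_)
    simpa using e.map_source (hsrc t ht).1
  obtain ⟨ε, hε, hball⟩ := Metric.eventually_nhds_iff_ball.1 htgt
  refine ⟨⟨ε, hε, ?_, fun s _ => ⟨?_, ?_⟩⟩, fun t ht => ?_, fun t ht => ?_⟩
  · rintro ⟨s, t⟩ ⟨hs, ht⟩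
    have hsnd : ContMDiffWithinAt 𝓘(ℝ, ℝ × ℝ) 𝓘(ℝ, ℝ) ∞ (Prod.snd : ℝ × ℝ → ℝ)
        (Ioo (-ε) ε ×ˢ Icc a b) (s, t) := contDiff_snd.contMDiff.contMDiffAt.contMDiffWithinAt
    by_cases hts : t ∈ tsupport φ
    · have hq := (hsrc t hts).1
      have hmaps : MapsTo (Prod.snd : ℝ × ℝ → ℝ) (Ioo (-ε) ε ×ˢ Icc a b) (Icc a b) :=
        fun p hp => hp.2
      have hg : ContDiffWithinAt ℝ ∞ (fun p : ℝ × ℝ => e (ξ p.2) + p.1 • Y p.2)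
          (Ioo (-ε) ε ×ˢ Icc a b) (s, t) :=
        ((hx t ht hq).comp (f := (Prod.snd : ℝ × ℝ → ℝ)) (s, t) contDiffWithinAt_snd hmaps).add
          (contDiffWithinAt_fst.smul
            ((hYs t hts).comp (f := (Prod.snd : ℝ × ℝ → ℝ)) (s, t) contDiffWithinAt_snd hmaps))
      have h1 : e (ξ t) + s • Y t ∈ e.target :=
        hball s (by rw [Real.ball_eq_Ioo]; simpa using hs) t hts
      have h2 := ContMDiffAt.comp_contMDiffWithinAt (s, t)
        (f := fun p : ℝ × ℝ => e (ξ p.2) + p.1 • Y p.2)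
        (contMDiffAt_symm_of_mem_maximalAtlas he h1) hg.contMDiffWithinAt
      refine h2.congr_of_eventuallyEq ?_ (hin s t hq)
      have hc : ContinuousWithinAt (fun p : ℝ × ℝ => ξ p.2) (Ioo (-ε) ε ×ˢ Icc a b) (s, t) :=
        (hξ.smooth t ht).continuousWithinAt.comp (f := (Prod.snd : ℝ × ℝ → ℝ)) (x := (s, t))
          continuousWithinAt_snd hmaps
      filter_upwards [hc.preimage_mem_nhdsWithin (e.open_source.mem_nhds hq)] with p hp
        using hin p.1 p.2 hp
    · have h1 := (hξ.smooth t ht).comp (f := (Prod.snd : ℝ × ℝ → ℝ)) (s, t) hsnd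
        fun p hp => hp.2
      refine h1.congr_of_eventuallyEq ?_ (hnot s t hts)
      filter_upwards [mem_nhdsWithin_of_mem_nhds (continuousAt_snd.preimage_mem_nhds
        ((isClosed_tsupport φ).isOpen_compl.mem_nhds hts))] with p hp using hnot p.1 p.2 hp
  · rw [hnot s a fun h => lt_irrefl _ (hφs h).1, hξ.left]
  · rw [hnot s b fun h => lt_irrefl _ (hφs h).2, hξ.right]
  · by_cases hts : t ∈ tsupport φ
    · rw [hin 0 t (hsrc t hts).1, zero_smul, add_zero, e.left_inv (hsrc t hts).1]
    · exact hnot 0 t hts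
  · by_cases hts : t ∈ tsupport φ
    · have hq := (hsrc t hts).1
      have hfun : (fun s => localizedVariation e φ X ξ s t)
          = e.symm ∘ fun s : ℝ => e (ξ t) + s • Y t := funext fun s => hin s t hq
      have hg : HasDerivAt (fun s : ℝ => e (ξ t) + s • Y t) (Y t) 0 := by
        simpa using ((hasDerivAt_id (0 : ℝ)).smul_const (Y t)).const_add (e (ξ t))
      have hg0 : e (ξ t) + (0 : ℝ) • Y t = e (ξ t) := by simp
      have h1 : MDifferentiableAt 𝓘(ℝ, E) 𝓘(ℝ, E) e.symm (e (ξ t) + (0 : ℝ) • Y t) := by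
        rw [hg0]
        exact mdifferentiableAt_chart_symm he (e.map_source hq)
      have h2 := tangentMap_comp_at (I := 𝓘(ℝ, ℝ)) (I' := 𝓘(ℝ, E)) (I'' := 𝓘(ℝ, E))
        (g := e.symm) (f := fun s : ℝ => e (ξ t) + s • Y t)
        (⟨0, (1 : ℝ)⟩ : TangentBundle 𝓘(ℝ, ℝ) ℝ) h1 hg.differentiableAt.mdifferentiableAt
      rw [← hfun] at h2
      refine Eq.trans h2 ?_
      have h3 : tangentMap 𝓘(ℝ, ℝ) 𝓘(ℝ, E) (fun s : ℝ => e (ξ t) + s • Y t)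
          (⟨0, (1 : ℝ)⟩ : TangentBundle 𝓘(ℝ, ℝ) ℝ) = ⟨e (ξ t), Y t⟩ := by
        have h4 : fderiv ℝ (fun s : ℝ => e (ξ t) + s • Y t) 0 1 = Y t := hg.deriv
        simp only [tangentMap, mfderiv_eq_fderiv]
        have h5 : ∀ (y w : E), y = e (ξ t) → w = Y t →
            (⟨y, w⟩ : TangentBundle 𝓘(ℝ, E) E) = ⟨e (ξ t), Y t⟩ := by rintro _ _ rfl rfl; rfl
        exact h5 _ _ hg0 h4
      rw [h3]
      refine Eq.trans ?_ (mk_chart_symm_eq he hq (φ t • X (ξ t)))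
      have h6 : chartDiff e (ξ t) (φ t • X (ξ t)) = Y t := (chartDiff e (ξ t)).map_smul _ _
      rw [h6]
      rfl
    · have hfun : (fun s => localizedVariation e φ X ξ s t) = fun _ => ξ t :=
        funext fun s => hnot s t hts
      have h1 : tangentMap 𝓘(ℝ, ℝ) 𝓘(ℝ, E) (fun s => localizedVariation e φ X ξ s t)
          (⟨0, (1 : ℝ)⟩ : TangentBundle 𝓘(ℝ, ℝ) ℝ) = ⟨ξ t, 0⟩ := by
        rw [hfun]
        simp only [tangentMap, mfderiv_const]
        rfl
      refine Eq.trans h1 ?_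
      rw [image_eq_zero_of_notMem_tsupport hts, zero_smul]

/-- This makes strict positivity at one time persist nearby. The chart is fixed, since a family of
charts `e t` need not depend continuously on `t`. -/
theorem continuousWithinAt_herglotzCovector
    (hL : ContMDiff (𝓘(ℝ, E).tangent.prod 𝓘(ℝ, ℝ)) 𝓘(ℝ, ℝ) ∞ L)
    (hab : a < b) (hξ : IsPath (E := E) a b q₁ q₂ ξ) (hZ : InActionDomain L a b ξ)
    (he : e ∈ IsManifold.maximalAtlas 𝓘(ℝ, E) ∞ Q) (hU : IsOpen U)
    (hX : ContMDiffOn 𝓘(ℝ, E) 𝓘(ℝ, E).tangent ∞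
      (fun q => (⟨q, X q⟩ : TangentBundle 𝓘(ℝ, E) Q)) U)
    (ht : t ∈ Icc a b) (hq : ξ t ∈ e.source) (hqU : ξ t ∈ U) :
    ContinuousWithinAt (fun τ => herglotzCovector L e a b ξ τ (X (ξ τ))) (Icc a b) t := by
  have hx := contDiffWithinAt_chart_curve hξ he ht hq
  have hz := contDiffOn_herglotzZ hL hab hξ hZ t ht
  have hℓ : ContDiffAt ℝ ∞ (fun y : (E × E) × ℝ => chartLagrangian L e y.1.1 y.1.2 y.2)
      ((e (ξ t), derivWithin (fun τ => e (ξ τ)) (Icc a b) t), herglotzZ L a b ξ t) :=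
    contDiffAt_chartLagrangian hL he (e.map_source hq)
  have h1 : ContinuousWithinAt (partialPosition L e a b ξ) (Icc a b) t :=
    continuousWithinAt_position hab ht hx hz hℓ
  have h2 : ContDiffWithinAt ℝ 1 (partialVelocity L e a b ξ) (Icc a b) t :=
    contDiffWithinAt_momentum hab ht hx hz hℓ
  have h3 : ContDiffWithinAt ℝ 0 (derivWithin (partialVelocity L e a b ξ) (Icc a b))
      (Icc a b) t := contDiffWithinAt_derivWithin hab ht h2 (by norm_num)
  have h4 := continuousOn_partialAction hL hab hξ hZ t ht
  have h5 := (contDiffWithinAt_chart_field hξ he hU hX ht hq hqU).continuousWithinAt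
  exact ((h1.clm_apply h5).sub (h3.continuousWithinAt.clm_apply h5)).add
    (h4.mul (h2.continuousWithinAt.clm_apply h5))

end Localized

/-! ### The two implications -/

section Main

variable {E : Type*} [NormedAddCommGroup E] [NormedSpace ℝ E]
  {Q : Type*} [TopologicalSpace Q] [ChartedSpace E Q] [IsManifold 𝓘(ℝ, E) ∞ Q]
  {L : TangentBundle 𝓘(ℝ, E) Q × ℝ → ℝ} {a b : ℝ} {q₁ q₂ : Q} {ξ : ℝ → Q}
  {Δ : (q : Q) → Submodule ℝ (TangentSpace 𝓘(ℝ, E) q)}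

/-- Every vector of a regular distribution extends to a local smooth section. -/
theorem IsRegularDistribution.exists_section {k : ℕ} (hΔ : IsRegularDistribution k Δ) {q₀ : Q}
    {u : TangentSpace 𝓘(ℝ, E) q₀} (hu : u ∈ Δ q₀) :
    ∃ (U : Set Q) (X : (q : Q) → TangentSpace 𝓘(ℝ, E) q), IsOpen U ∧ q₀ ∈ U ∧
      ContMDiffOn 𝓘(ℝ, E) 𝓘(ℝ, E).tangent ∞
        (fun q => (⟨q, X q⟩ : TangentBundle 𝓘(ℝ, E) Q)) U ∧
      (∀ q ∈ U, X q ∈ Δ q) ∧ X q₀ = u := by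
  obtain ⟨r, -, h⟩ := hΔ
  obtain ⟨U, hU, hqU, X, hX, hspan⟩ := h q₀
  rw [(hspan q₀ hqU).2, Submodule.mem_span_range_iff_exists_fun] at hu
  obtain ⟨f, hf⟩ := hu
  -- The coordinates of `u` in the local frame are kept constant.
  refine ⟨U, fun q => ∑ i, f i • X i q, hU, hqU, ?_, fun q hq => ?_, hf⟩
  · exact ContMDiffOn.sum_section fun i _ => (hX i).const_smul_section
  · rw [(hspan q hq).2]
    exact Submodule.sum_mem _ fun i _ =>
      Submodule.smul_mem _ _ (Submodule.subset_span (mem_range_self i))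

theorem critical_of_herglotzCovector
    (hL : ContMDiff (𝓘(ℝ, E).tangent.prod 𝓘(ℝ, ℝ)) 𝓘(ℝ, ℝ) ∞ L)
    (hab : a < b) (hξ : IsPath (E := E) a b q₁ q₂ ξ) (hZ : InActionDomain L a b ξ)
    {e : ℝ → OpenPartialHomeomorph Q E}
    (he : ∀ t ∈ Icc a b, e t ∈ IsManifold.maximalAtlas 𝓘(ℝ, E) ∞ Q ∧ ξ t ∈ (e t).source)
    (hcov : ∀ t ∈ Icc a b, herglotzCovector L (e t) a b ξ t ∈ (Δ (ξ t)).dualAnnihilator)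
    {v : (t : ℝ) → TangentSpace 𝓘(ℝ, E) (ξ t)} (hv : IsInfinitesimalVariation a b ξ v)
    (hvΔ : ∀ t ∈ Icc a b, v t ∈ Δ (ξ t)) : HasActionDeriv L a b q₁ q₂ ξ v 0 := by
  intro c hc
  obtain ⟨y, hya, hy, hyb⟩ := first_variation_formula hL hab hξ hZ he hv.left hv.right hc
  have h0 := linear_ode_eq_zero (continuousOn_partialAction hL hab hξ hZ)
    (fun t ht => by
      have := hy t ht
      rwa [(Submodule.mem_dualAnnihilator _).1 (hcov t ht) _ (hvΔ t ht), zero_add] at this) hya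
  rwa [h0 b (right_mem_Icc.2 hab.le)] at hyb

/-- A bump variation would otherwise give a nonnegative source that is not identically zero. One
sign is enough, as `Δ` is closed under negation. -/
theorem herglotzCovector_nonpos_of_critical
    (hL : ContMDiff (𝓘(ℝ, E).tangent.prod 𝓘(ℝ, ℝ)) 𝓘(ℝ, ℝ) ∞ L) {k : ℕ}
    (hΔ : IsRegularDistribution k Δ)
    (hab : a < b) (hξ : IsPath (E := E) a b q₁ q₂ ξ) (hZ : InActionDomain L a b ξ)
    {e : ℝ → OpenPartialHomeomorph Q E}
    (he : ∀ t ∈ Icc a b, e t ∈ IsManifold.maximalAtlas 𝓘(ℝ, E) ∞ Q ∧ ξ t ∈ (e t).source)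
    (hcrit : ∀ v : (t : ℝ) → TangentSpace 𝓘(ℝ, E) (ξ t), IsInfinitesimalVariation a b ξ v →
      (∀ t ∈ Icc a b, v t ∈ Δ (ξ t)) → HasActionDeriv L a b q₁ q₂ ξ v 0)
    {t₀ : ℝ} (ht₀ : t₀ ∈ Icc a b) {u : TangentSpace 𝓘(ℝ, E) (ξ t₀)} (hu : u ∈ Δ (ξ t₀)) :
    herglotzCovector L (e t₀) a b ξ t₀ u ≤ 0 := by
  by_contra! hpos
  obtain ⟨U, X, hU, hqU, hX, hXΔ, rfl⟩ := hΔ.exists_section hu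
  obtain ⟨he₀, hq⟩ := he t₀ ht₀
  have hev : ∀ᶠ t in 𝓝[Icc a b] t₀,
      0 < herglotzCovector L (e t₀) a b ξ t (X (ξ t)) ∧ ξ t ∈ (e t₀).source ∩ U :=
    ((continuousWithinAt_herglotzCovector hL hab hξ hZ he₀ hU hX ht₀ hq hqU).eventually
      (lt_mem_nhds hpos)).and ((hξ.smooth t₀ ht₀).continuousWithinAt.preimage_mem_nhdsWithin
        (((e t₀).open_source.inter hU).mem_nhds ⟨hq, hqU⟩))
  obtain ⟨O, hO, ht₀O, hOsub⟩ := mem_nhdsWithin.1 hev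
  -- The time `t₀` may be an endpoint, where no bump supported in `(a, b)` can be centred;
  -- positivity allows a move to an interior time `t₁`.
  have hcl : t₀ ∈ closure (Ioo a b) := by rwa [closure_Ioo hab.ne]
  obtain ⟨t₁, ht₁O, ht₁⟩ := mem_closure_iff.1 hcl O hO ht₀O
  obtain ⟨r, hr, hball⟩ := Metric.isOpen_iff.1 (hO.inter isOpen_Ioo) t₁ ⟨ht₁O, ht₁⟩
  let φ : ContDiffBump t₁ := ⟨r / 4, r / 2, by linarith, by linarith⟩
  have hφsub : tsupport φ ⊆ O ∩ Ioo a b := by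
    rw [φ.tsupport_eq]
    exact (Metric.closedBall_subset_ball (by change r / 2 < r; linarith)).trans hball
  have hφP : ∀ t ∈ tsupport φ, 0 < herglotzCovector L (e t₀) a b ξ t (X (ξ t)) ∧
      ξ t ∈ (e t₀).source ∩ U :=
    fun t ht => hOsub ⟨(hφsub ht).1, Ioo_subset_Icc_self (hφsub ht).2⟩
  have hφs : tsupport φ ⊆ Ioo a b := fun t ht => (hφsub ht).2
  have hvar := isInfinitesimalVariation_localized hξ he₀ hU hX φ.contDiff hφs
    fun t ht => (hφP t ht).2
  have hc := isVariation_localized hξ he₀ hU hX φ.contDiff φ.hasCompactSupport hφs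
    fun t ht => (hφP t ht).2
  have h0 : ∀ t, t ∉ tsupport φ → φ t • X (ξ t) = 0 := fun t ht => by
    rw [image_eq_zero_of_notMem_tsupport ht, zero_smul]
  have hvΔ : ∀ t ∈ Icc a b, φ t • X (ξ t) ∈ Δ (ξ t) := fun t _ => by
    by_cases ht : t ∈ tsupport φ
    · exact Submodule.smul_mem _ _ (hXΔ _ (hφP t ht).2.2)
    · rw [h0 t ht]
      exact Submodule.zero_mem _
  have hderiv := hcrit _ hvar hvΔ _ hc
  classical
  -- The single chart `e t₀` is used throughout the support of the bump, where positivity is known;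
  -- the given charts serve wherever `ξ` leaves its source.
  set e' : ℝ → OpenPartialHomeomorph Q E :=
    fun t => if ξ t ∈ (e t₀).source then e t₀ else e t with he'def
  have he' : ∀ t ∈ Icc a b,
      e' t ∈ IsManifold.maximalAtlas 𝓘(ℝ, E) ∞ Q ∧ ξ t ∈ (e' t).source := fun t ht => by
    by_cases h : ξ t ∈ (e t₀).source
    · simpa [he'def, h] using he₀
    · simpa [he'def, h] using he t ht
  have hcov : ∀ t ∈ tsupport φ, herglotzCovector L (e' t) a b ξ t (φ t • X (ξ t))
      = φ t * herglotzCovector L (e t₀) a b ξ t (X (ξ t)) := fun t ht => by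
    rw [map_smul, smul_eq_mul, he'def]
    simp only [if_pos (hφP t ht).2.1]
  obtain ⟨y, hya, hy, hyb⟩ :=
    first_variation_formula hL hab hξ hZ he' hvar.left hvar.right hc
  have hzero := linear_ode_source_eq_zero hab.le (continuousOn_partialAction hL hab hξ hZ) hy
    (fun t _ => by
      by_cases ht : t ∈ tsupport φ
      · rw [hcov t ht]
        exact mul_nonneg φ.nonneg (hφP t ht).1.le
      · rw [h0 t ht, map_zero])
    hya (hyb.unique hderiv) ht₁
  have ht₁s : t₁ ∈ tsupport φ := by
    rw [φ.tsupport_eq]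
    exact Metric.mem_closedBall_self φ.rOut_pos.le
  rw [hcov t₁ ht₁s] at hzero
  exact (mul_pos (φ.pos_of_mem_ball (Metric.mem_ball_self φ.rOut_pos)) (hφP t₁ ht₁s).1).ne' hzero

end Main

end Herglotz

end

theorem mainTheorem2
    {E : Type*} [NormedAddCommGroup E] [NormedSpace ℝ E] [FiniteDimensional ℝ E]
    {Q : Type*} [TopologicalSpace Q] [T2Space Q] [SecondCountableTopology Q]
    [ChartedSpace E Q] [IsManifold 𝓘(ℝ, E) ∞ Q]
    (L : TangentBundle 𝓘(ℝ, E) Q × ℝ → ℝ)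
    (hL : ContMDiff (𝓘(ℝ, E).tangent.prod 𝓘(ℝ, ℝ)) 𝓘(ℝ, ℝ) ∞ L)
    (k : ℕ) (Δ : (q : Q) → Submodule ℝ (TangentSpace 𝓘(ℝ, E) q))
    (hΔ : Herglotz.IsRegularDistribution k Δ)
    (a b : ℝ) (hab : a < b) (q₁ q₂ : Q) (ξ : ℝ → Q)
    (hξ : Herglotz.IsPath (E := E) a b q₁ q₂ ξ)
    (hZ : Herglotz.InActionDomain L a b ξ)
    (e : ℝ → OpenPartialHomeomorph Q E)
    (he : ∀ t ∈ Set.Icc a b,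
      e t ∈ IsManifold.maximalAtlas 𝓘(ℝ, E) ∞ Q ∧ ξ t ∈ (e t).source) :
    Herglotz.SatisfiesConstrainedPrinciple L Δ a b q₁ q₂ ξ ↔
      (∀ t ∈ Set.Icc a b,
        Herglotz.herglotzCovector L (e t) a b ξ t ∈ (Δ (ξ t)).dualAnnihilator) ∧
      (∀ t ∈ Set.Icc a b, Herglotz.velocity a b ξ t ∈ Δ (ξ t)) := by
  constructor
  · rintro ⟨hcrit, hcon⟩
    -- The opposite inequality is the same one applied to `-u`.
    refine ⟨fun t ht => (Submodule.mem_dualAnnihilator _).2 fun u hu => le_antisymm ?_ ?_, hcon⟩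
    · exact Herglotz.herglotzCovector_nonpos_of_critical hL hΔ hab hξ hZ he hcrit ht hu
    · have := Herglotz.herglotzCovector_nonpos_of_critical hL hΔ hab hξ hZ he hcrit ht
        (Submodule.neg_mem _ hu)
      rw [map_neg] at this
      linarith
  · rintro ⟨hcov, hcon⟩
    exact ⟨fun v hv hvΔ =>
      Herglotz.critical_of_herglotzCovector hL hab hξ hZ he hcov hv hvΔ, hcon⟩
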